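/- There is an absolute constant $C>0$ such that the following holds. Let $\mathbb H$ be a real separable Hilbert space and let $\xi,\eta$ be Gaussian random elements of $\mathbb H$, defined on a common probability space, with zero mean and covariance operators $\Sigma_\xi,\Sigma_\eta$. Then for every $a\in\mathbb H$, $$\sup_{x>0}\bigl|\mathbb P(\|\xi-a\|\le x)-\mathbb P(\|\eta\|\le x)\bigr|\;\le\; C\,\bigl\{\varkappa(\Sigma_\xi)+\varkappa(\Sigma_\eta)\bigr\}\bigl(\|\Sigma_\xi-\Sigma_\eta\|_1+\|a\|^2\bigr).$$ Here $\|A\|_1=\operatorname{tr}|A|=\sum_k|\lambda_k(A)|$ is the nuclear norm of a self-adjoint nuclear operator $A$, where $\lambda_k(A)$ are its eigenvalues repeated according to multiplicity. For a covariance operator $\Sigma$ let $\lambda_1\ge\lambda_2\ge\dots\ge 0$ be its eigenvalues repeated according to multiplicity (and continued by zeros if $\Sigma$ has finite rank), let $\Lambda_k=\bigl(\sum_{j\ge k}\lambda_j^2\bigr)^{1/2}$ for $k=1,2$, and put $$\varkappa(\Sigma)=\begin{cases}\Lambda_1^{-1}, & 3\lambda_1^2\le\Lambda_1^2,\\ (\lambda_1\Lambda_2)^{-1/2},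 & 3\lambda_1^2>\Lambda_1^2,\ 3\lambda_2^2\le\Lambda_2^2,\\ (\lambda_1\lambda_2)^{-1/2}, & 3\lambda_1^2>\Lambda_1^2,\ 3\lambda_2^2>\Lambda_2^2,\end{cases}$$ with the conventions $1/0=+\infty$ (so $\varkappa(\Sigma)=+\infty$ when $\Sigma$ has rank at most one) and $\infty\cdot 0=0$. -/

import Mathlib

open MeasureTheory ProbabilityTheory
open scoped ENNReal

noncomputable section

namespace GaussianComparison

variable {H : Type*} [NormedAddCommGroup H] [InnerProductSpace ℝ H]

/-- The eigenspace of a bounded operator `T` for the real number `ν`. -/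
def eigenspace (T : H →L[ℝ] H) (ν : ℝ) : Submodule ℝ H :=
  Module.End.eigenspace (T : H →ₗ[ℝ] H) ν

/-- The multiplicity of `ν` as an eigenvalue of `T` (zero if `ν` is not an eigenvalue). -/
def eigenMult (T : H →L[ℝ] H) (ν : ℝ) : ℕ∞ :=
  Cardinal.toENat (Module.rank ℝ (eigenspace T ν))

/-- The eigenvalues of a positive compact operator `T`, in non-increasing order and repeated
according to multiplicity; `eigenvalue T k` is the `(k + 1)`-st one. It is the largest `t > 0` such
that the eigenvectors with eigenvalue at least `t` span a space of dimension at least `k + 1`.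
If there are at most `k` positive eigenvalues, the set below is empty and the value is `0`. -/
def eigenvalue (T : H →L[ℝ] H) (k : ℕ) : ℝ :=
  sSup {t : ℝ | 0 < t ∧
    ((k + 1 : ℕ) : Cardinal) ≤ Module.rank ℝ ↥(⨆ ν ∈ Set.Ici t, eigenspace T ν)}

/-- The nuclear norm of a (compact) self-adjoint operator `A`: the sum of the absolute values of
its eigenvalues, each counted with its multiplicity. -/
def nuclearNorm (A : H →L[ℝ] H) : ℝ≥0∞ :=
  ∑' ν : ℝ, ENNReal.ofReal |ν| * (eigenMult A ν : ℝ≥0∞)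

/-- The square of the tail `Λ_{k+1}`: the sum of the squares of the eigenvalues of `T` from the
`(k + 1)`-st one on. -/
def tailSq (T : H →L[ℝ] H) (k : ℕ) : ℝ≥0∞ :=
  ∑' j : ℕ, ENNReal.ofReal (eigenvalue T (k + j) ^ 2)

/-- `Λ_{k+1}`, the `ℓ²` norm of the eigenvalues from the `(k + 1)`-st one on. -/
def tail (T : H →L[ℝ] H) (k : ℕ) : ℝ≥0∞ :=
  tailSq T k ^ (1 / 2 : ℝ)

open scoped Classical in
/-- The quantity `ϰ(T)`, with the convention `1 / 0 = ∞`; so for a covariance operator it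
is `∞` exactly when the rank is at most one. -/
def kappa (T : H →L[ℝ] H) : ℝ≥0∞ :=
  if 3 * ENNReal.ofReal (eigenvalue T 0 ^ 2) ≤ tailSq T 0 then
    (tail T 0)⁻¹
  else if 3 * ENNReal.ofReal (eigenvalue T 1 ^ 2) ≤ tailSq T 1 then
    (ENNReal.ofReal (eigenvalue T 0) * tail T 1) ^ (-(1 / 2) : ℝ)
  else
    (ENNReal.ofReal (eigenvalue T 0) * ENNReal.ofReal (eigenvalue T 1)) ^ (-(1 / 2) : ℝ)

end GaussianComparison

end

noncomputable section

namespace GaussianComparison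

-- Two one-sided facts carry the proof. If `ρ` is a law on the line with `AntiConc ρ K`, adding an
-- independent nonnegative variable of mean `m` can only lower the distribution function, and lowers
-- it by at most `K * m` (`AntiConc.conv_Iic`). And moving the centre of a ball by `b` amounts to
-- adding such a variable, of mean at most `‖b‖ ^ 2`, to the squared norm. Indeed, along an
-- eigenvector of the covariance the squared norm splits into independent summands
-- (`normSqLaw_eq_conv`), and a noncentral Gaussian square is the central one plus an independent
-- compound Poisson variable of mean `b ^ 2` (`exists_sqGaussian_eq_conv`). Hence
-- `normSqLaw_Iic_shift`, and, by averaging over random centres, the same bound for added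
-- independent noise (`normSqLaw_conv_Iic`).
--
-- To compare two covariances, write their difference as `D⁺ - D⁻`. Adding noise with covariance
-- `D⁻` to the first element and noise with covariance `D⁺` to the second gives the same law
-- (`exists_conv_eq_conv`), and the second moments of the noises add up to at most the nuclear norm
-- of `D`. Each passage costs an anti-concentration constant times a second moment, so no smoothing
-- error arises.
--
-- It remains to bound that constant by a multiple of `kappa` (`antiConc_normSqLaw_kappa`). The
-- modulus of the characteristic function of the squared norm is at most a product of factors `(1 +
-- 4 t² λ²)^(-1/4)`. When no eigenvalue dominates, or only the first does, a suitable partial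
-- product is integrable with the right scaling. When two dominate, this bound may decay only like
-- `1/|t|`; there the bounded planar density of two coordinates and the area of an annulus are used
-- instead.

universe u

/-! ### Characteristic functions of Gaussian squares and exponential laws -/

/-- The law of `(X - b) ^ 2` for a centred Gaussian `X` of variance `v`. -/
def sqGaussian (v : NNReal) (b : ℝ) : Measure ℝ :=
  (gaussianReal 0 v).map (fun y => (y - b) ^ 2)

instance (v : NNReal) (b : ℝ) : IsProbabilityMeasure (sqGaussian v b) :=
  Measure.isProbabilityMeasure_map (by fun_prop)

lemma charFun_sqGaussian {v : NNReal} (hv : v ≠ 0) (b t : ℝ) :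
    charFun (sqGaussian v b) t =
      ((√(2 * Real.pi * v))⁻¹ : ℝ) *
        ((Real.pi / -(t * Complex.I - 1 / (2 * v)) : ℂ) ^ (1 / 2 : ℂ) *
          Complex.exp (t * Complex.I * b ^ 2 + t ^ 2 * b ^ 2 / (t * Complex.I - 1 / (2 * v)))) := by
  have hv' : (0 : ℝ) < v := by positivity
  -- `B` is the quadratic coefficient of `i t (y - b)² - y² / (2 v)`; completing the square needs
  -- its real part to be negative.
  set B : ℂ := t * Complex.I - 1 / (2 * v) with hB
  have hBre : B.re < 0 := by
    have : B.re = - (1 / (2 * v) : ℝ) := by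
      have h : B = (t : ℂ) * Complex.I - ((1 / (2 * v) : ℝ) : ℂ) := by rw [hB]; push_cast; rfl
      rw [h, Complex.sub_re, Complex.ofReal_re]
      simp
    rw [this]
    have : (0 : ℝ) < 1 / (2 * v) := by positivity
    linarith
  have hB0 : B ≠ 0 := by
    intro h; rw [h] at hBre; simp at hBre
  rw [charFun_apply_real, sqGaussian, integral_map (by fun_prop) (by fun_prop),
    integral_gaussianReal_eq_integral_smul hv]
  have key := integral_cexp_quadratic hBre (-2 * t * Complex.I * b) (t * Complex.I * b ^ 2)
  have hexp : (t * Complex.I * b ^ 2 - (-2 * t * Complex.I * b) ^ 2 / (4 * B) : ℂ) =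
      t * Complex.I * b ^ 2 + t ^ 2 * b ^ 2 / B := by
    have : (-2 * t * Complex.I * b : ℂ) ^ 2 = -4 * t ^ 2 * b ^ 2 := by
      have := Complex.I_sq
      linear_combination (4 * t ^ 2 * b ^ 2 : ℂ) * this
    rw [this]; field_simp; ring
  rw [hexp] at key
  rw [← key, ← integral_const_mul]
  congr 1
  ext x
  rw [gaussianPDFReal_def]
  simp only [Complex.real_smul]
  push_cast
  rw [mul_assoc, ← Complex.exp_add]
  congr 2
  rw [hB]
  have : (v : ℂ) ≠ 0 := by exact_mod_cast hv'.ne'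
  field_simp
  ring

lemma charFun_sqGaussian_eq_mul {v : NNReal} (hv : v ≠ 0) (b t : ℝ) :
    charFun (sqGaussian v b) t = charFun (sqGaussian v 0) t *
      Complex.exp (t * Complex.I * b ^ 2 + t ^ 2 * b ^ 2 / (t * Complex.I - 1 / (2 * v))) := by
  rw [charFun_sqGaussian hv b, charFun_sqGaussian hv 0]
  simp [mul_assoc]

/-- The shift enters only through an exponential of modulus at most one, because `B⁻¹` has negative
real part. The bound is therefore uniform in `b`. -/
lemma norm_charFun_sqGaussian_le (v : NNReal) (b t : ℝ) :
    ‖charFun (sqGaussian v b) t‖ ≤ (1 + 4 * t ^ 2 * v ^ 2) ^ (-(1 / 4) : ℝ) := by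
  by_cases hv : v = 0
  · subst hv
    simpa using norm_charFun_le_one (μ := sqGaussian 0 b) t
  have hv' : (0 : ℝ) < v := by positivity
  rw [charFun_sqGaussian hv]
  have h : (t * Complex.I - 1 / (2 * v) : ℂ) = ((-(1 / (2 * v)) : ℝ) : ℂ) + (t : ℝ) * Complex.I := by
    push_cast; ring
  set B : ℂ := t * Complex.I - 1 / (2 * v) with hB
  have hre : B.re = -(1 / (2 * v) : ℝ) := by rw [h]; simp
  have hnorm : ‖B‖ = (1 / (2 * v)) * √(1 + 4 * t ^ 2 * v ^ 2) := by
    rw [h, Complex.norm_add_mul_I]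
    rw [show (-(1 / (2 * v)) : ℝ) ^ 2 + t ^ 2 = (1 / (2 * v)) ^ 2 * (1 + 4 * t ^ 2 * v ^ 2) by
      field_simp; ring]
    rw [Real.sqrt_mul (by positivity), Real.sqrt_sq (by positivity)]
  have hE : ‖Complex.exp (t * Complex.I * b ^ 2 + t ^ 2 * b ^ 2 / B)‖ ≤ 1 := by
    rw [Complex.norm_exp, Real.exp_le_one_iff]
    have h1 : (t * Complex.I * b ^ 2 + t ^ 2 * b ^ 2 / B : ℂ) =
        ((t * b ^ 2 : ℝ) : ℂ) * Complex.I + ((t ^ 2 * b ^ 2 : ℝ) : ℂ) * B⁻¹ := by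
      push_cast; ring
    rw [h1, Complex.add_re, Complex.re_ofReal_mul, Complex.re_ofReal_mul, Complex.inv_re, hre]
    have : -(1 / (2 * v) : ℝ) / Complex.normSq B ≤ 0 :=
      div_nonpos_of_nonpos_of_nonneg (by simp) (Complex.normSq_nonneg _)
    have h2 : 0 ≤ t ^ 2 * b ^ 2 := by positivity
    simp only [Complex.I_re, mul_zero, zero_add]
    exact mul_nonpos_of_nonneg_of_nonpos h2 this
  rw [norm_mul, norm_mul]
  have hpow : ‖(Real.pi / -B : ℂ) ^ (1 / 2 : ℂ)‖ = (Real.pi / ‖B‖) ^ (1 / 2 : ℝ) := by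
    rw [show (1 / 2 : ℂ) = ((1 / 2 : ℝ) : ℂ) by push_cast; rfl, Complex.norm_cpow_real]
    simp [abs_of_pos Real.pi_pos]
  rw [hpow, hnorm]
  have h2 : (Real.pi / (1 / (2 * v) * √(1 + 4 * t ^ 2 * v ^ 2))) ^ (1 / 2 : ℝ) =
      √(2 * Real.pi * v) * (1 + 4 * t ^ 2 * v ^ 2) ^ (-(1 / 4) : ℝ) := by
    rw [show Real.pi / (1 / (2 * v) * √(1 + 4 * t ^ 2 * v ^ 2)) =
      (2 * Real.pi * v) * (√(1 + 4 * t ^ 2 * v ^ 2))⁻¹ by field_simp]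
    rw [Real.mul_rpow (by positivity) (by positivity), Real.sqrt_eq_rpow,
      Real.sqrt_eq_rpow, ← Real.rpow_neg (by positivity), ← Real.rpow_mul (by positivity)]
    norm_num
  rw [h2]
  have h3 : 0 < √(2 * Real.pi * v) := by positivity
  rw [Complex.norm_real, Real.norm_of_nonneg (by positivity)]
  calc _ = (1 + 4 * t ^ 2 * v ^ 2) ^ (-(1 / 4) : ℝ) *
        ‖Complex.exp (t * Complex.I * b ^ 2 + t ^ 2 * b ^ 2 / B)‖ := by
        field_simp
    _ ≤ _ := mul_le_of_le_one_right (by positivity) hE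

lemma charFun_expMeasure {r : ℝ} (hr : 0 < r) (t : ℝ) :
    charFun (expMeasure r) t = r / (r - t * Complex.I) := by
  have hd : expMeasure r = (volume.restrict (Set.Ioi 0)).withDensity
      (fun x => ENNReal.ofReal (r * Real.exp (-(r * x)))) := by
    rw [← restrict_withDensity measurableSet_Ioi]
    have : expMeasure r = volume.withDensity (exponentialPDF r) := rfl
    rw [this]
    refine Measure.ext fun s hs => ?_
    rw [Measure.restrict_apply hs, withDensity_apply _ hs,
      withDensity_apply _ (hs.inter measurableSet_Ioi), ← lintegral_indicator hs,
      ← lintegral_indicator (hs.inter measurableSet_Ioi)]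
    refine lintegral_congr_ae ?_
    filter_upwards [compl_mem_ae_iff.2 (measure_singleton (0 : ℝ))] with x hx
    have hx : x ≠ 0 := hx
    rcases lt_or_gt_of_ne hx with h | h
    · simp [Set.indicator, exponentialPDF_of_neg h, not_lt.2 h.le]
    · by_cases hxs : x ∈ s
      · rw [Set.indicator_of_mem hxs, Set.indicator_of_mem (show x ∈ s ∩ Set.Ioi 0 from ⟨hxs, h⟩),
          exponentialPDF_of_nonneg h.le]
      · rw [Set.indicator_of_notMem hxs, Set.indicator_of_notMem fun hx => hxs hx.1]
  rw [charFun_apply_real, hd, integral_withDensity_eq_integral_toReal_smul (by fun_prop) (by simp)]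
  have hre : (-(r - t * Complex.I) : ℂ).re < 0 := by simpa using hr
  have := integral_exp_mul_complex_Ioi hre 0
  simp only [Complex.ofReal_zero, mul_zero, Complex.exp_zero] at this
  calc _ = ∫ x in Set.Ioi (0 : ℝ), (r : ℂ) * Complex.exp (-(r - t * Complex.I) * x) := by
        congr 1; ext x
        rw [ENNReal.toReal_ofReal (by positivity), Complex.real_smul]
        push_cast
        rw [mul_assoc, ← Complex.exp_add]
        congr 2; ring
    _ = _ := by
        rw [integral_const_mul, this]
        rw [neg_div_neg_eq]; ring

/-- Multiplying the exponential density by `x` gives `r⁻¹` times the Gamma density of shape two,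
whose mass is one. -/
lemma lintegral_expMeasure {r : ℝ} (hr : 0 < r) :
    ∫⁻ x, ENNReal.ofReal x ∂(expMeasure r) = ENNReal.ofReal r⁻¹ := by
  have hd : expMeasure r = volume.withDensity (gammaPDF 1 r) := rfl
  have hmeas : ∀ a, Measurable (gammaPDF a r) := fun a => by unfold gammaPDF; fun_prop
  rw [hd, lintegral_withDensity_eq_lintegral_mul _ (hmeas 1) (by fun_prop)]
  rw [← mul_one (ENNReal.ofReal r⁻¹), ← lintegral_gammaPDF_eq_one two_pos hr,
    ← lintegral_const_mul _ (hmeas 2)]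
  congr 1; ext x
  simp only [Pi.mul_apply]
  rcases lt_or_ge x 0 with h | h
  · simp [gammaPDF_of_neg h]
  · rw [gammaPDF_of_nonneg h, gammaPDF_of_nonneg h, ← ENNReal.ofReal_mul (by positivity),
      ← ENNReal.ofReal_mul (by positivity)]
    congr 1
    norm_num
    field_simp

lemma expMeasure_nonneg {r : ℝ} : ∀ᵐ x ∂(expMeasure r), 0 ≤ x := by
  have : expMeasure r = volume.withDensity (exponentialPDF r) := rfl
  rw [this, ae_withDensity_iff (by unfold exponentialPDF; fun_prop)]
  refine Filter.Eventually.of_forall fun x hx => ?_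
  by_contra h
  exact hx (exponentialPDF_of_neg (not_le.1 h))

/-! ### Compound Poisson laws and the noncentral Gaussian square -/

/-- Convolution powers of a measure on the real line. -/
def convPow (κ : Measure ℝ) : ℕ → Measure ℝ
  | 0 => Measure.dirac 0
  | n + 1 => convPow κ n ∗ κ

instance (κ : Measure ℝ) [IsProbabilityMeasure κ] (n : ℕ) : IsProbabilityMeasure (convPow κ n) := by
  induction n with
  | zero => rw [convPow]; infer_instance
  | succ n ih => rw [convPow]; infer_instance

lemma charFun_convPow (κ : Measure ℝ) [IsProbabilityMeasure κ] (n : ℕ) (t : ℝ) :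
    charFun (convPow κ n) t = charFun κ t ^ n := by
  induction n with
  | zero => simp [convPow]
  | succ n ih => rw [convPow, charFun_conv, ih, pow_succ]

lemma conv_nonneg {κ ρ : Measure ℝ} [SFinite κ] [SFinite ρ] (hκ : ∀ᵐ x ∂κ, 0 ≤ x)
    (hρ : ∀ᵐ x ∂ρ, 0 ≤ x) : ∀ᵐ x ∂(κ ∗ ρ), 0 ≤ x := by
  rw [Measure.conv, ae_map_iff (by fun_prop) measurableSet_Ici]
  have h1 : ∀ᵐ z ∂(κ.prod ρ), 0 ≤ z.1 := Measure.quasiMeasurePreserving_fst.ae hκ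
  have h2 : ∀ᵐ z ∂(κ.prod ρ), 0 ≤ z.2 := Measure.quasiMeasurePreserving_snd.ae hρ
  filter_upwards [h1, h2] with z h1 h2 using add_nonneg h1 h2

lemma lintegral_conv_le {κ ρ : Measure ℝ} [IsProbabilityMeasure κ] [IsProbabilityMeasure ρ] :
    ∫⁻ x, ENNReal.ofReal x ∂(κ ∗ ρ) ≤
      ∫⁻ x, ENNReal.ofReal x ∂κ + ∫⁻ x, ENNReal.ofReal x ∂ρ := by
  rw [Measure.lintegral_conv (by fun_prop)]
  calc _ ≤ ∫⁻ x, ∫⁻ y, (ENNReal.ofReal x + ENNReal.ofReal y) ∂ρ ∂κ := by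
        gcongr; exact ENNReal.ofReal_add_le
    _ = ∫⁻ x, (ENNReal.ofReal x + ∫⁻ y, ENNReal.ofReal y ∂ρ) ∂κ := by
        congr 1; ext x
        rw [lintegral_add_left (by fun_prop)]; simp
    _ = _ := by
        rw [lintegral_add_left (by fun_prop)]; simp

lemma convPow_nonneg {κ : Measure ℝ} [IsProbabilityMeasure κ] (hκ : ∀ᵐ x ∂κ, 0 ≤ x) (n : ℕ) :
    ∀ᵐ x ∂(convPow κ n), 0 ≤ x := by
  induction n with
  | zero => rw [convPow, ae_dirac_iff measurableSet_Ici]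
  | succ n ih => exact conv_nonneg ih hκ

lemma lintegral_convPow_le (κ : Measure ℝ) [IsProbabilityMeasure κ] (n : ℕ) :
    ∫⁻ x, ENNReal.ofReal x ∂(convPow κ n) ≤ n * ∫⁻ x, ENNReal.ofReal x ∂κ := by
  induction n with
  | zero => simp [convPow]
  | succ n ih =>
    rw [convPow]
    refine lintegral_conv_le.trans ?_
    rw [Nat.cast_succ, add_mul, one_mul]
    gcongr

lemma hasSum_poisson_mul_pow (m : ℝ) (z : ℂ) :
    HasSum (fun n : ℕ => ((Real.exp (-m) * m ^ n / n.factorial : ℝ) : ℂ) * z ^ n)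
      (Complex.exp (m * (z - 1))) := by
  have h := (NormedSpace.expSeries_div_hasSum_exp (m * z : ℂ)).mul_left (Complex.exp (-m))
  rw [← Complex.exp_eq_exp_ℂ, ← Complex.exp_add] at h
  rw [show (m * (z - 1) : ℂ) = -m + m * z by ring]
  refine h.congr_fun fun n => ?_
  push_cast; rw [mul_pow]; ring

lemma hasSum_poisson_mul_nat (m : ℝ) :
    HasSum (fun n : ℕ => Real.exp (-m) * m ^ n / n.factorial * n) m := by
  have h := (NormedSpace.expSeries_div_hasSum_exp (m : ℝ)).mul_left (Real.exp (-m) * m)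
  rw [← Real.exp_eq_exp_ℝ, mul_right_comm, ← Real.exp_add, neg_add_cancel, Real.exp_zero,
    one_mul] at h
  rw [← hasSum_nat_add_iff' 1]
  simp only [Finset.range_one, Finset.sum_singleton, Nat.cast_zero, mul_zero, sub_zero]
  refine h.congr_fun fun n => ?_
  rw [Nat.factorial_succ]
  push_cast
  field_simp
  ring

/-- The compound Poisson law with intensity `m` and jump law `κ`. -/
def compoundPoisson (m : ℝ) (κ : Measure ℝ) : Measure ℝ :=
  Measure.sum fun n : ℕ => ENNReal.ofReal (Real.exp (-m) * m ^ n / n.factorial) • convPow κ n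

lemma isProbabilityMeasure_compoundPoisson {m : ℝ} (hm : 0 ≤ m) (κ : Measure ℝ)
    [IsProbabilityMeasure κ] : IsProbabilityMeasure (compoundPoisson m κ) := by
  constructor
  rw [compoundPoisson, Measure.sum_apply _ MeasurableSet.univ]
  simp only [Measure.smul_apply, measure_univ, smul_eq_mul, mul_one]
  have h : HasSum (fun n : ℕ => Real.exp (-m) * m ^ n / n.factorial) 1 := by
    have := hasSum_poisson_mul_pow m 1
    simpa [← Complex.ofReal_exp, ← Complex.ofReal_pow, ← Complex.hasSum_ofReal] using
      (Complex.hasSum_re this)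
  rw [← ENNReal.ofReal_tsum_of_nonneg (fun n => by positivity) h.summable, h.tsum_eq]
  simp

lemma charFun_compoundPoisson {m : ℝ} (hm : 0 ≤ m) (κ : Measure ℝ)
    [IsProbabilityMeasure κ] (t : ℝ) :
    charFun (compoundPoisson m κ) t = Complex.exp (m * (charFun κ t - 1)) := by
  have := isProbabilityMeasure_compoundPoisson hm κ
  rw [charFun_apply_real, compoundPoisson, integral_sum_measure]
  · rw [← (hasSum_poisson_mul_pow m (charFun κ t)).tsum_eq]
    congr 1; ext n
    rw [integral_smul_measure, ← charFun_apply_real, charFun_convPow,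
      ENNReal.toReal_ofReal (by positivity), Complex.real_smul]
  · change Integrable _ (compoundPoisson m κ)
    refine Integrable.of_bound (by fun_prop) 1 (Filter.Eventually.of_forall fun x => ?_)
    rw [← Complex.ofReal_mul, Complex.norm_exp_ofReal_mul_I]

lemma compoundPoisson_nonneg {m : ℝ} {κ : Measure ℝ} [IsProbabilityMeasure κ]
    (hκ : ∀ᵐ x ∂κ, 0 ≤ x) : ∀ᵐ x ∂(compoundPoisson m κ), 0 ≤ x := by
  rw [compoundPoisson, Measure.ae_sum_iff]
  intro n
  exact Measure.ae_smul_measure (convPow_nonneg hκ n) _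

lemma lintegral_compoundPoisson_le {m : ℝ} (hm : 0 ≤ m) (κ : Measure ℝ) [IsProbabilityMeasure κ] :
    ∫⁻ x, ENNReal.ofReal x ∂(compoundPoisson m κ) ≤
      ENNReal.ofReal m * ∫⁻ x, ENNReal.ofReal x ∂κ := by
  rw [compoundPoisson, lintegral_sum_measure]
  simp only [lintegral_smul_measure, smul_eq_mul]
  calc _ ≤ ∑' n : ℕ, ENNReal.ofReal (Real.exp (-m) * m ^ n / n.factorial) *
        (n * ∫⁻ x, ENNReal.ofReal x ∂κ) := by
        gcongr; exact lintegral_convPow_le κ _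
    _ = (∑' n : ℕ, ENNReal.ofReal (Real.exp (-m) * m ^ n / n.factorial * n)) *
        ∫⁻ x, ENNReal.ofReal x ∂κ := by
        rw [← ENNReal.tsum_mul_right]
        congr 1; ext n
        rw [ENNReal.ofReal_mul (by positivity), ENNReal.ofReal_natCast, mul_assoc]
    _ = _ := by
        rw [← ENNReal.ofReal_tsum_of_nonneg (fun n => by positivity)
          (hasSum_poisson_mul_nat m).summable, (hasSum_poisson_mul_nat m).tsum_eq]

/-- The noncentral square of a Gaussian variable is the sum of the central one and an independent
nonnegative variable of mean at most the square of the shift. -/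
lemma exists_sqGaussian_eq_conv (v : NNReal) (b : ℝ) :
    ∃ ν : Measure ℝ, IsProbabilityMeasure ν ∧ (∀ᵐ x ∂ν, 0 ≤ x) ∧
      ∫⁻ x, ENNReal.ofReal x ∂ν ≤ ENNReal.ofReal (b ^ 2) ∧
      sqGaussian v b = sqGaussian v 0 ∗ ν := by
  by_cases hv : v = 0
  · subst hv
    refine ⟨Measure.dirac (b ^ 2), inferInstance, ?_, ?_, ?_⟩
    · rw [ae_dirac_iff measurableSet_Ici]; positivity
    · simp
    · have h : ∀ c : ℝ, sqGaussian 0 c = Measure.dirac (c ^ 2) := fun c => by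
        rw [sqGaussian, gaussianReal_zero_var, Measure.map_dirac' (by fun_prop : Measurable fun y : ℝ => (y - c) ^ 2)]
        simp
      rw [h, h, Measure.dirac_conv_dirac]; simp
  have hv' : (0 : ℝ) < v := by positivity
  have hr : (0 : ℝ) < 1 / (2 * v) := by positivity
  have hm : (0 : ℝ) ≤ b ^ 2 / (2 * v) := by positivity
  have := isProbabilityMeasure_expMeasure hr
  have := isProbabilityMeasure_compoundPoisson hm (expMeasure (1 / (2 * v)))
  -- A noncentral chi-square is a Poisson mixture of central ones with extra pairs of degrees of
  -- freedom, and each extra pair, scaled by `v`, is exponential of rate `1 / (2 v)`. Intensity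
  -- times mean jump is `b ^ 2 / (2 v) * (2 v) = b ^ 2`.
  refine ⟨compoundPoisson (b ^ 2 / (2 * v)) (expMeasure (1 / (2 * v))), inferInstance,
    compoundPoisson_nonneg expMeasure_nonneg, ?_, ?_⟩
  · refine (lintegral_compoundPoisson_le hm _).trans (le_of_eq ?_)
    rw [lintegral_expMeasure hr, ← ENNReal.ofReal_mul hm]
    congr 1
    field_simp
  · refine Measure.ext_of_charFun ?_
    ext t
    rw [charFun_conv, charFun_sqGaussian_eq_mul hv b, charFun_compoundPoisson hm,
      charFun_expMeasure hr]
    congr 2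
    have hv0 : (v : ℂ) ≠ 0 := by exact_mod_cast hv'.ne'
    have h1 : (t * Complex.I - 1 / (2 * v) : ℂ) ≠ 0 := by
      intro h
      have := congrArg Complex.re h
      rw [show (t * Complex.I - 1 / (2 * v) : ℂ) =
        (t : ℂ) * Complex.I - ((1 / (2 * v) : ℝ) : ℂ) by push_cast; rfl] at this
      simp at this
      exact hv this
    have h2 : ((1 / (2 * v) : ℝ) - t * Complex.I : ℂ) ≠ 0 := by
      intro h; apply h1; push_cast at h; linear_combination -h
    rw [show ((1 / (2 * v) : ℝ) : ℂ) / ((1 / (2 * v) : ℝ) - t * Complex.I) - 1 =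
      (-(t * Complex.I)) / (t * Complex.I - 1 / (2 * v)) by
        rw [div_sub_one h2, div_eq_div_iff h2 h1]; push_cast; ring]
    have hB : ((b ^ 2 / (2 * v) : ℝ) : ℂ) = (b : ℂ) ^ 2 * (1 / (2 * v)) := by push_cast; ring
    rw [hB]
    generalize (1 / (2 * v) : ℂ) = w at *
    rw [← mul_div_assoc, eq_div_iff h1, add_mul, div_mul_cancel₀ _ h1]
    linear_combination (t ^ 2 * b ^ 2 : ℂ) * Complex.I_sq

/-! ### Anti-concentration on the line -/

/-- The concentration function of `ρ` on half-open intervals is at most `K` times the length. -/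
def AntiConc (ρ : Measure ℝ) (K : ℝ≥0∞) : Prop :=
  ∀ x τ : ℝ, 0 ≤ τ → ρ (Set.Ioc (x - τ) x) ≤ K * ENNReal.ofReal τ

lemma AntiConc.mono {ρ : Measure ℝ} {K K' : ℝ≥0∞} (h : AntiConc ρ K) (hK : K ≤ K') :
    AntiConc ρ K' := fun x τ hτ => (h x τ hτ).trans (by gcongr)

/-- This covers the cases where `kappa` is infinite. Since `∞ * 0 = 0`, length zero needs the
half-open interval to be empty. -/
lemma antiConc_top (ρ : Measure ℝ) : AntiConc ρ ∞ := by
  intro x τ hτ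
  rcases hτ.eq_or_lt with rfl | h
  · simp
  · rw [ENNReal.top_mul (by simpa using h)]; exact le_top

lemma conv_apply_eq_lintegral {M : Type*} [AddMonoid M] [MeasurableSpace M] [MeasurableAdd₂ M]
    {ρ κ : Measure M} [SFinite ρ] [SFinite κ] {A : Set M}
    (hA : MeasurableSet A) : (ρ ∗ κ) A = ∫⁻ t, ρ ((fun y => y + t) ⁻¹' A) ∂κ := by
  rw [Measure.conv, Measure.map_apply (by fun_prop) hA,
    Measure.prod_apply_symm (by measurability)]
  rfl

lemma AntiConc.conv {ρ κ : Measure ℝ} [SFinite ρ] [IsProbabilityMeasure κ] {K : ℝ≥0∞}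
    (h : AntiConc ρ K) : AntiConc (ρ ∗ κ) K := by
  intro x τ hτ
  rw [conv_apply_eq_lintegral measurableSet_Ioc]
  calc _ ≤ ∫⁻ t, K * ENNReal.ofReal τ ∂κ := by
        refine lintegral_mono fun t => ?_
        have : (fun y => y + t) ⁻¹' Set.Ioc (x - τ) x = Set.Ioc (x - t - τ) (x - t) := by
          rw [Set.preimage_add_const_Ioc]; congr 1; ring
        rw [this]
        exact h _ _ hτ
    _ = _ := by simp

/-- Adding an independent nonnegative variable changes the distribution function by at most the
anti-concentration constant times its mean. -/
lemma AntiConc.conv_Iic {ρ ν : Measure ℝ} [SFinite ρ] [IsProbabilityMeasure ν] {K : ℝ≥0∞}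
    (h : AntiConc ρ K) (hν : ∀ᵐ t ∂ν, 0 ≤ t) (x : ℝ) :
    (ρ ∗ ν) (Set.Iic x) ≤ ρ (Set.Iic x) ∧
      ρ (Set.Iic x) ≤ (ρ ∗ ν) (Set.Iic x) + K * ∫⁻ t, ENNReal.ofReal t ∂ν := by
  rw [conv_apply_eq_lintegral measurableSet_Iic]
  simp_rw [Set.preimage_add_const_Iic]
  have hm : Measurable fun t => ρ (Set.Iic (x - t)) := by
    refine Antitone.measurable fun s t hst => measure_mono (Set.Iic_subset_Iic.2 (by linarith))
  constructor
  · calc _ ≤ ∫⁻ t, ρ (Set.Iic x) ∂ν := by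
          refine lintegral_mono_ae ?_
          filter_upwards [hν] with t ht
          exact measure_mono (Set.Iic_subset_Iic.2 (by linarith))
      _ = _ := by simp
  · calc ρ (Set.Iic x) = ∫⁻ t, ρ (Set.Iic x) ∂ν := by simp
      _ ≤ ∫⁻ t, (ρ (Set.Iic (x - t)) + K * ENNReal.ofReal t) ∂ν := by
          refine lintegral_mono_ae ?_
          filter_upwards [hν] with t ht
          have : Set.Iic x = Set.Iic (x - t) ∪ Set.Ioc (x - t) x :=
            (Set.Iic_union_Ioc_eq_Iic (by linarith)).symm
          rw [this]
          exact (measure_union_le _ _).trans (by gcongr; exact h x t ht)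
      _ = _ := by
          rw [lintegral_add_left hm, lintegral_const_mul _ (by fun_prop)]

lemma gaussianPDFReal_le (m : ℝ) (v : NNReal) (x : ℝ) :
    gaussianPDFReal m v x ≤ (√(2 * Real.pi * v))⁻¹ := by
  rw [gaussianPDFReal_def]
  refine mul_le_of_le_one_right (by positivity) ?_
  rw [Real.exp_le_one_iff, neg_div]
  exact neg_nonpos.2 (by positivity)

lemma gaussianReal_le_smul_volume (m : ℝ) {v : NNReal} (hv : v ≠ 0) :
    gaussianReal m v ≤ ENNReal.ofReal (√(2 * Real.pi * v))⁻¹ • (volume : Measure ℝ) := by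
  rw [gaussianReal_of_var_ne_zero m hv, ← withDensity_const]
  refine withDensity_mono (Filter.Eventually.of_forall fun x => ?_)
  exact ENNReal.ofReal_le_ofReal (gaussianPDFReal_le m v x)

/-- An Esseen-type inequality. A Gaussian bump around the midpoint of the interval is itself the
characteristic function of a Gaussian `G`; by Fubini its `ρ`-integral becomes an integral of
`charFun ρ` against the bounded density of `G`. -/
lemma antiConc_of_charFun_le {ρ : Measure ℝ} [IsProbabilityMeasure ρ] {g : ℝ → ℝ}
    (hg : Integrable g) (hρ : ∀ᵐ t, ‖charFun ρ t‖ ≤ g t) :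
    AntiConc ρ (ENNReal.ofReal (∫ t, g t)) := by
  intro x τ hτ
  rcases hτ.eq_or_lt with rfl | hτ
  · simp
  have hI : 0 ≤ ∫ t, g t := by
    refine integral_nonneg_of_ae ?_
    filter_upwards [hρ] with t ht using (norm_nonneg _).trans ht
  set x0 := x - τ / 2 with hx0
  -- With this variance the bump is at least `exp (-1/2) ≥ 1/2` on the interval and the density of
  -- `G` is at most `τ / 2`, so the final constant is one.
  set v : NNReal := ⟨4 / τ ^ 2, by positivity⟩ with hv
  have hvr : (v : ℝ) = 4 / τ ^ 2 := rfl
  have hv0 : v ≠ 0 := by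
    rw [← NNReal.coe_ne_zero, hvr]; positivity
  set G := gaussianReal 0 v with hG
  have hch : ∀ q : ℝ, charFun G (q - x0) = ((Real.exp (-(v * (q - x0) ^ 2 / 2)) : ℝ) : ℂ) := by
    intro q
    rw [hG, charFun_gaussianReal]
    push_cast
    congr 1; ring
  have hbd : ‖∫ q, charFun G (q - x0) ∂ρ‖ ≤ (√(2 * Real.pi * v))⁻¹ * ∫ t, g t := by
    simp_rw [charFun_apply_real]
    rw [integral_integral_swap]
    · have hin : ∀ s : ℝ, ∫ q, Complex.exp (((q - x0 : ℝ) : ℂ) * s * Complex.I) ∂ρ =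
          Complex.exp (((-x0 * s : ℝ) : ℂ) * Complex.I) * charFun ρ s := by
        intro s
        rw [charFun_apply_real, ← integral_const_mul]
        congr 1; ext q
        rw [← Complex.exp_add]
        push_cast
        congr 1; ring
      simp_rw [hin]
      rw [hG, integral_gaussianReal_eq_integral_smul hv0]
      calc _ ≤ ∫ s, (√(2 * Real.pi * v))⁻¹ * g s := by
            refine norm_integral_le_of_norm_le (hg.const_mul _) ?_
            filter_upwards [hρ] with s hs
            rw [norm_smul, norm_mul, Complex.norm_exp_ofReal_mul_I, one_mul,
              Real.norm_of_nonneg (gaussianPDFReal_nonneg _ _ _)]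
            exact mul_le_mul (gaussianPDFReal_le _ _ _) hs (norm_nonneg _) (by positivity)
        _ = _ := integral_const_mul _ _
    · refine Integrable.of_bound (by fun_prop) 1 (Filter.Eventually.of_forall fun z => ?_)
      simp only [Function.uncurry]
      rw [← Complex.ofReal_mul, Complex.norm_exp_ofReal_mul_I]
  have hreal : ∫ q, Real.exp (-(v * (q - x0) ^ 2 / 2)) ∂ρ ≤ (√(2 * Real.pi * v))⁻¹ * ∫ t, g t := by
    simp_rw [hch] at hbd
    rw [integral_complex_ofReal, Complex.norm_real] at hbd
    exact (le_abs_self _).trans hbd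
  have hint : Integrable (fun q => Real.exp (-(v * (q - x0) ^ 2 / 2))) ρ := by
    refine Integrable.of_bound (by fun_prop) 1 (Filter.Eventually.of_forall fun z => ?_)
    rw [Real.norm_of_nonneg (by positivity), Real.exp_le_one_iff]
    exact neg_nonpos.2 (by positivity)
  have hmark : ρ.real (Set.Ioc (x - τ) x) * Real.exp (-(1 / 2)) ≤
      ∫ q, Real.exp (-(v * (q - x0) ^ 2 / 2)) ∂ρ := by
    calc _ = ∫ q in Set.Ioc (x - τ) x, Real.exp (-(1 / 2)) ∂ρ := by simp
      _ ≤ ∫ q in Set.Ioc (x - τ) x, Real.exp (-(v * (q - x0) ^ 2 / 2)) ∂ρ := by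
          refine setIntegral_mono_on (by simp) hint.integrableOn measurableSet_Ioc fun q hq => ?_
          rw [Real.exp_le_exp, neg_le_neg_iff, hvr]
          have h1 : (q - x0) ^ 2 ≤ (τ / 2) ^ 2 := by
            refine sq_le_sq' ?_ ?_ <;> rw [hx0] <;> linarith [hq.1, hq.2]
          calc 4 / τ ^ 2 * (q - x0) ^ 2 / 2 ≤ 4 / τ ^ 2 * (τ / 2) ^ 2 / 2 := by gcongr
            _ = 1 / 2 := by field_simp; norm_num
      _ ≤ _ := setIntegral_le_integral hint (Filter.Eventually.of_forall fun q => by positivity)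
  have hsq : (√(2 * Real.pi * v))⁻¹ ≤ τ / 2 := by
    rw [inv_le_comm₀ (by positivity) (by positivity)]
    refine Real.le_sqrt_of_sq_le ?_
    rw [hvr, inv_div, div_pow]
    have : (2 : ℝ) ^ 2 / τ ^ 2 = 4 / τ ^ 2 := by norm_num
    rw [this]
    refine le_mul_of_one_le_left (by positivity) ?_
    linarith [Real.pi_gt_three]
  have hexp : 1 / 2 ≤ Real.exp (-(1 / 2)) := by
    have := Real.add_one_le_exp (-(1 / 2) : ℝ)
    linarith
  have hfin : ρ.real (Set.Ioc (x - τ) x) ≤ (∫ t, g t) * τ := by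
    have h0 : 0 ≤ ρ.real (Set.Ioc (x - τ) x) := measureReal_nonneg
    have h1 : (√(2 * Real.pi * v))⁻¹ * ∫ t, g t ≤ τ / 2 * ∫ t, g t := by gcongr
    have h2 : ρ.real (Set.Ioc (x - τ) x) * (1 / 2) ≤
      ρ.real (Set.Ioc (x - τ) x) * Real.exp (-(1 / 2)) := by gcongr
    linarith
  rw [← ENNReal.ofReal_mul hI, ← ofReal_measureReal]
  exact ENNReal.ofReal_le_ofReal hfin

/-- The area of a planar annulus depends only on the difference of the squared radii. For negative
`A` the set lies in a full disc, and `π B ≤ π (B - A)`. -/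
lemma volume_annulus_le (b1 b2 A B : ℝ) :
    (volume.prod volume : Measure (ℝ × ℝ))
      {z | (z.1 - b1) ^ 2 + (z.2 - b2) ^ 2 ∈ Set.Ioc A B} ≤ ENNReal.ofReal (Real.pi * (B - A)) := by
  have hmeas : MeasurableSet {z : ℝ × ℝ | (z.1 - b1) ^ 2 + (z.2 - b2) ^ 2 ∈ Set.Ioc A B} := by
    have : Measurable fun z : ℝ × ℝ => (z.1 - b1) ^ 2 + (z.2 - b2) ^ 2 := by fun_prop
    exact this measurableSet_Ioc
  rw [← Measure.volume_eq_prod, ← Complex.volume_preserving_equiv_real_prod.measure_preimage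
    hmeas.nullMeasurableSet]
  set c : ℂ := ⟨b1, b2⟩
  rcases lt_or_ge B 0 with hB | hB
  · refine le_of_eq_of_le (measure_mono_null (t := ∅) ?_ measure_empty) zero_le
    intro z hz
    have h1 := hz.2
    simp only [Complex.measurableEquivRealProd_apply] at h1
    nlinarith [sq_nonneg (z.re - b1), sq_nonneg (z.im - b2)]
  have hsub : Complex.measurableEquivRealProd ⁻¹'
      {z : ℝ × ℝ | (z.1 - b1) ^ 2 + (z.2 - b2) ^ 2 ∈ Set.Ioc A B} ⊆
      Metric.closedBall c √B \ Metric.ball c √A := by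
    intro z hz
    have hd : dist z c ^ 2 = (z.re - b1) ^ 2 + (z.im - b2) ^ 2 := by
      rw [Complex.dist_eq, ← Complex.normSq_eq_norm_sq, Complex.normSq_apply]
      simp [c]; ring
    have h1 : (z.re - b1) ^ 2 + (z.im - b2) ^ 2 ∈ Set.Ioc A B := hz
    rw [← hd] at h1
    refine ⟨Real.le_sqrt_of_sq_le h1.2, ?_⟩
    rw [Metric.mem_ball, not_lt]
    rw [Real.sqrt_le_left dist_nonneg]
    exact h1.1.le
  refine (measure_mono hsub).trans ?_
  rcases lt_or_ge A 0 with hA | hA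
  · refine (measure_mono Set.sdiff_subset).trans ?_
    rw [Complex.volume_closedBall, ← ENNReal.ofReal_pow (Real.sqrt_nonneg _), Real.sq_sqrt hB]
    rw [← ENNReal.ofReal_coe_nnreal, ← ENNReal.ofReal_mul hB, NNReal.coe_real_pi]
    refine ENNReal.ofReal_le_ofReal ?_
    nlinarith [Real.pi_pos]
  rcases lt_or_ge B A with hBA | hBA
  · rw [Set.sdiff_eq_empty.2 _]
    · simp
    · exact Metric.closedBall_subset_ball (Real.sqrt_lt_sqrt hB hBA)
  rw [measure_sdiff (Metric.ball_subset_closedBall.trans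
      (Metric.closedBall_subset_closedBall (Real.sqrt_le_sqrt hBA)))
      Metric.isOpen_ball.measurableSet.nullMeasurableSet (by simp [Complex.volume_ball]; finiteness),
    Complex.volume_closedBall, Complex.volume_ball, ← ENNReal.ofReal_pow (Real.sqrt_nonneg _),
    Real.sq_sqrt hB, ← ENNReal.ofReal_pow (Real.sqrt_nonneg _), Real.sq_sqrt hA,
    ← ENNReal.ofReal_coe_nnreal, ← ENNReal.ofReal_mul hB, ← ENNReal.ofReal_mul hA,
    NNReal.coe_real_pi, ← ENNReal.ofReal_sub _ (by positivity)]
  refine ENNReal.ofReal_le_ofReal (by linarith)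

/-- The joint density is at most `1 / (2π √(v w))` and the event is an annulus of area at most `π
τ`, which gives half of the claimed bound. Two characteristic function factors alone would decay
only like `1/|t|`, which is not integrable. -/
lemma antiConc_sqGaussian_conv {v w : NNReal} (hv : v ≠ 0) (hw : w ≠ 0) (b c : ℝ) :
    AntiConc (sqGaussian v b ∗ sqGaussian w c) (ENNReal.ofReal (√(v * w))⁻¹) := by
  intro x τ hτ
  have hmap : sqGaussian v b ∗ sqGaussian w c = ((gaussianReal 0 v).prod (gaussianReal 0 w)).map
      (fun z => (z.1 - b) ^ 2 + (z.2 - c) ^ 2) := by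
    rw [Measure.conv, sqGaussian, sqGaussian, Measure.map_prod_map _ _ (by fun_prop) (by fun_prop),
      Measure.map_map (by fun_prop) (by fun_prop)]
    rfl
  have hmeas : MeasurableSet {z : ℝ × ℝ | (z.1 - b) ^ 2 + (z.2 - c) ^ 2 ∈ Set.Ioc (x - τ) x} := by
    have : Measurable fun z : ℝ × ℝ => (z.1 - b) ^ 2 + (z.2 - c) ^ 2 := by fun_prop
    exact this measurableSet_Ioc
  rw [hmap, Measure.map_apply (by fun_prop) measurableSet_Ioc]
  have hle : (gaussianReal 0 v).prod (gaussianReal 0 w) ≤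
      (ENNReal.ofReal (√(2 * Real.pi * v))⁻¹ * ENNReal.ofReal (√(2 * Real.pi * w))⁻¹) •
        (volume.prod volume : Measure (ℝ × ℝ)) := by
    refine (Measure.prod_mono (gaussianReal_le_smul_volume 0 hv)
      (gaussianReal_le_smul_volume 0 hw)).trans (le_of_eq ?_)
    rw [Measure.prod_smul_left, Measure.prod_smul_right, smul_smul]
  refine (hle _).trans ?_
  rw [Measure.smul_apply, smul_eq_mul]
  refine (mul_le_mul_right (volume_annulus_le b c _ _) _).trans ?_
  rw [← ENNReal.ofReal_mul (by positivity), ← ENNReal.ofReal_mul (by positivity),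
    ← ENNReal.ofReal_mul (by positivity)]
  refine ENNReal.ofReal_le_ofReal ?_
  have hv' : (0 : ℝ) < v := by positivity
  have hw' : (0 : ℝ) < w := by positivity
  rw [← mul_inv, ← Real.sqrt_mul (by positivity),
    show 2 * Real.pi * v * (2 * Real.pi * w) = (2 * Real.pi) ^ 2 * (v * w) by ring,
    Real.sqrt_mul (by positivity), Real.sqrt_sq (by positivity), mul_inv]
  have hs : 0 ≤ (√(v * w : ℝ))⁻¹ := by positivity
  have : (2 * Real.pi)⁻¹ * (√(v * w : ℝ))⁻¹ * (Real.pi * (x - (x - τ))) =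
      (√(v * w : ℝ))⁻¹ * τ / 2 := by
    field_simp; ring
  rw [this]
  have := mul_nonneg hs hτ
  linarith

/-! ### Splitting off an eigendirection of the covariance -/

section DropDir

variable {H : Type*} [NormedAddCommGroup H] [InnerProductSpace ℝ H]

/-- The map that removes the component along the unit vector `e`. -/
def dropDir (e : H) : H →L[ℝ] H :=
  ContinuousLinearMap.id ℝ H - (innerSL ℝ e).smulRight e

lemma dropDir_apply (e z : H) : dropDir e z = z - inner ℝ e z • e := by simp [dropDir]

lemma dropDir_of_inner_eq_zero {e z : H} (h : inner ℝ e z = 0) : dropDir e z = z := by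
  simp [dropDir_apply, h]

lemma inner_dropDir_left (e y z : H) : inner ℝ (dropDir e y) z = inner ℝ y (dropDir e z) := by
  simp only [dropDir_apply, inner_sub_left, inner_sub_right, real_inner_smul_left,
    real_inner_smul_right]
  rw [real_inner_comm e y]; ring

lemma inner_self_dropDir {e : H} (he : ‖e‖ = 1) (z : H) : inner ℝ e (dropDir e z) = 0 := by
  simp [dropDir_apply, inner_sub_right, real_inner_smul_right, he]

lemma dropDir_self {e : H} (he : ‖e‖ = 1) : dropDir e e = 0 := by
  simp [dropDir_apply, he]

lemma norm_sub_sq_eq_dropDir {e : H} (he : ‖e‖ = 1) (z b : H) :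
    ‖z - b‖ ^ 2 = (inner ℝ e z - inner ℝ e b) ^ 2 + ‖dropDir e z - dropDir e b‖ ^ 2 := by
  have h : z - b = (inner ℝ e z - inner ℝ e b) • e + dropDir e (z - b) := by
    rw [dropDir_apply, inner_sub_right]; abel
  rw [← map_sub]
  conv_lhs => rw [h]
  rw [norm_add_sq_real, real_inner_smul_left, inner_self_dropDir he, norm_smul, he]
  simp

end DropDir

section Split

variable {H : Type*} [NormedAddCommGroup H] [InnerProductSpace ℝ H] [CompleteSpace H]
  [SecondCountableTopology H] [MeasurableSpace H] [BorelSpace H]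

/-- The law of the squared distance to `b`. -/
def normSqLaw {H : Type*} [NormedAddCommGroup H] [MeasurableSpace H] (μ : Measure H) (b : H) :
    Measure ℝ :=
  μ.map fun z => ‖z - b‖ ^ 2

instance (μ : Measure H) [IsProbabilityMeasure μ] (b : H) : IsProbabilityMeasure (normSqLaw μ b) :=
  Measure.isProbabilityMeasure_map (by fun_prop)

variable (μ : Measure H) [IsGaussian μ]

lemma inner_covarianceOperator (x y : H) :
    inner ℝ (covarianceOperator μ x) y = ∫ z, inner ℝ x z * inner ℝ y z ∂μ :=
  covarianceOperator_inner IsGaussian.memLp_two_id x y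

lemma integral_inner_eq_zero (h0 : ∫ z, z ∂μ = 0) (x : H) : ∫ z, inner ℝ x z ∂μ = 0 := by
  have := integral_inner (𝕜 := ℝ) (f := id) (μ := μ) IsGaussian.integrable_id x
  simp only [id] at this
  rw [this, h0, inner_zero_right]

lemma memLp_inner (x : H) : MemLp (fun z => inner ℝ x z) 2 μ :=
  IsGaussian.memLp_two_id.const_inner x

lemma covariance_inner (h0 : ∫ z, z ∂μ = 0) (x y : H) :
    cov[fun z => inner ℝ x z, fun z => inner ℝ y z; μ] = inner ℝ (covarianceOperator μ x) y := by
  rw [covariance_eq_sub (memLp_inner μ x) (memLp_inner μ y), inner_covarianceOperator,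
    integral_inner_eq_zero μ h0]
  simp

lemma charFun_of_centered (h0 : ∫ z, z ∂μ = 0) (x : H) :
    charFun μ x = Complex.exp (-((inner ℝ (covarianceOperator μ x) x : ℝ) : ℂ) / 2) := by
  rw [IsGaussian.charFun_eq', covarianceBilin_apply_eq_cov IsGaussian.memLp_two_id,
    covariance_inner μ h0]
  simp [h0]
  ring_nf

lemma integral_map_dropDir (h0 : ∫ z, z ∂μ = 0) (e : H) : ∫ z, z ∂(μ.map (dropDir e)) = 0 := by
  rw [integral_map (by fun_prop) (by fun_prop)]
  have := (dropDir e).integral_comp_comm (μ := μ) (φ := id) IsGaussian.integrable_id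
  simp only [id] at this
  rw [this, h0, map_zero]

/-- Eigenvectors orthogonal to `e` remain eigenvectors after projection, so directions can be
removed successively without leaving the space `H`. -/
lemma covarianceOperator_map_dropDir (e f : H) (hf : inner ℝ e f = 0) :
    covarianceOperator (μ.map (dropDir e)) f = dropDir e (covarianceOperator μ f) := by
  refine ext_inner_right ℝ fun y => ?_
  rw [inner_covarianceOperator, inner_dropDir_left, inner_covarianceOperator,
    integral_map (by fun_prop) (by fun_prop)]
  congr 1; ext z
  rw [← inner_dropDir_left, dropDir_of_inner_eq_zero hf, ← inner_dropDir_left]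

lemma map_inner_eq_gaussianReal (h0 : ∫ z, z ∂μ = 0) {e : H} (he : ‖e‖ = 1) {l : ℝ}
    (hl : covarianceOperator μ e = l • e) :
    μ.map (fun z => inner ℝ e z) = gaussianReal 0 l.toNNReal := by
  have h := IsGaussian.map_eq_gaussianReal (μ := μ) (innerSL ℝ e)
  have hv : Var[fun z => inner ℝ e z; μ] = l := by
    rw [← covariance_self (by fun_prop), covariance_inner μ h0, hl, real_inner_smul_left,
      real_inner_self_eq_norm_sq, he]
    simp
  have h2 : ⇑(innerSL ℝ e) = fun z => inner ℝ e z := by ext; simp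
  rw [h2] at h
  simp only at h
  rw [h, integral_inner_eq_zero μ h0, hv]

/-- Since `e` is an eigenvector, the coordinate along `e` and the remaining component are
uncorrelated; being jointly Gaussian, they are independent. Pythagoras turns this into a
convolution. -/
lemma normSqLaw_eq_conv (h0 : ∫ z, z ∂μ = 0) {e : H} (he : ‖e‖ = 1) {l : ℝ}
    (hl : covarianceOperator μ e = l • e) (b : H) :
    normSqLaw μ b = sqGaussian l.toNNReal (inner ℝ e b) ∗
      normSqLaw (μ.map (dropDir e)) (dropDir e b) := by
  have hG : HasGaussianLaw (fun z => (inner ℝ e z, dropDir e z)) μ := by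
    constructor
    have : IsGaussian (μ.map ((innerSL ℝ e).prod (dropDir e))) := inferInstance
    exact this
  have hind : IndepFun (fun z => inner ℝ e z) (fun z => dropDir e z) μ := by
    refine hG.indepFun_of_covariance_inner fun x y => ?_
    have h1 : (fun z : H => inner ℝ x (inner ℝ e z : ℝ)) = fun z => inner ℝ e z * x := by
      ext z; simp
    have h2 : (fun z : H => inner ℝ y (dropDir e z)) = fun z => inner ℝ (dropDir e y) z := by
      ext z; rw [inner_dropDir_left]
    rw [h1, h2, covariance_mul_const_left, covariance_inner μ h0, hl, real_inner_smul_left,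
      inner_self_dropDir he]
    simp
  have hind2 := hind.comp (φ := fun t : ℝ => (t - inner ℝ e b) ^ 2)
    (ψ := fun z : H => ‖z - dropDir e b‖ ^ 2) (by fun_prop) (by fun_prop)
  have h3 := hind2.map_add_eq_map_conv_map (by fun_prop) (by fun_prop)
  have h4 : (fun z => ‖z - b‖ ^ 2) = (fun t : ℝ => (t - inner ℝ e b) ^ 2) ∘ (fun z => inner ℝ e z) +
      (fun z : H => ‖z - dropDir e b‖ ^ 2) ∘ fun z => dropDir e z := by
    ext z; simp [norm_sub_sq_eq_dropDir he z b]
  rw [normSqLaw, h4, h3, sqGaussian, ← map_inner_eq_gaussianReal μ h0 he hl,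
    Measure.map_map (by fun_prop) (by fun_prop), normSqLaw,
    Measure.map_map (by fun_prop) (by fun_prop)]

end Split

/-- Ball inclusion by the triangle inequality: each centre is within half of `√x' - √x` of `b`.
Allowing two centres gives the comparison in both directions. -/
lemma exists_normSqLaw_Iic_le {H : Type*} [NormedAddCommGroup H] [MeasurableSpace H]
    [BorelSpace H] (μ : Measure H) (b : H) {x x' : ℝ} (hx : 0 ≤ x) (hxx : x < x') :
    ∃ δ > 0, ∀ c c' : H, ‖c - b‖ < δ → ‖c' - b‖ < δ →
      normSqLaw μ c (Set.Iic x) ≤ normSqLaw μ c' (Set.Iic x') := by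
  have hs : √x < √x' := Real.sqrt_lt_sqrt hx hxx
  refine ⟨(√x' - √x) / 2, by linarith, fun c c' hc hc' => ?_⟩
  rw [normSqLaw, normSqLaw, Measure.map_apply (by fun_prop) measurableSet_Iic,
    Measure.map_apply (by fun_prop) measurableSet_Iic]
  refine measure_mono fun z hz => ?_
  have hz : ‖z - c‖ ^ 2 ≤ x := hz
  have h1 : ‖z - c‖ ≤ √x := Real.le_sqrt_of_sq_le hz
  have h2 : ‖z - c'‖ ≤ √x' := by
    have e : z - c' = (z - c) + (c - b) - (c' - b) := by abel
    rw [e]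
    have := norm_sub_le ((z - c) + (c - b)) (c' - b)
    have := norm_add_le (z - c) (c - b)
    linarith
  calc ‖z - c'‖ ^ 2 ≤ √x' ^ 2 := by gcongr
    _ = x' := Real.sq_sqrt (hx.trans hxx.le)

lemma tendsto_measure_Iic_right (ρ : Measure ℝ) [IsProbabilityMeasure ρ] (x : ℝ) :
    Filter.Tendsto (fun y => ρ (Set.Iic y)) (nhdsWithin x (Set.Ioi x)) (nhds (ρ (Set.Iic x))) := by
  simp_rw [← ofReal_cdf ρ]
  exact (ENNReal.continuous_ofReal.tendsto _).comp
    (((cdf ρ).right_continuous x).tendsto.mono_left (nhdsWithin_mono _ Set.Ioi_subset_Ici_self))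

/-! ### Characteristic function bound, shifted centres and added noise -/

section Shift

variable {H : Type*} [NormedAddCommGroup H] [InnerProductSpace ℝ H] [CompleteSpace H]
  [SecondCountableTopology H] [MeasurableSpace H] [BorelSpace H]

/-- Each eigenvector splits off one factor, and what is left after `s` has modulus at most one. The
measure and the centre are quantified after the induction variable because the induction hypothesis
is applied to the projected measure. -/
lemma norm_charFun_normSqLaw_le {ι : Type*} {e : ι → H} (he : Orthonormal ℝ e) {l : ι → ℝ}
    (hl0 : ∀ i, 0 ≤ l i) (s : Finset ι) (t : ℝ) :
    ∀ (μ : Measure H) [IsGaussian μ] (_ : ∫ z, z ∂μ = 0)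
      (_ : ∀ i ∈ s, covarianceOperator μ (e i) = l i • e i) (b : H),
      ‖charFun (normSqLaw μ b) t‖ ≤ ∏ i ∈ s, (1 + 4 * t ^ 2 * l i ^ 2) ^ (-(1 / 4) : ℝ) := by
  classical
  induction s using Finset.induction_on with
  | empty => intro μ _ h0 hl b; simpa using norm_charFun_le_one (μ := normSqLaw μ b) t
  | insert j s hj ih =>
    intro μ _ h0 hl b
    rw [normSqLaw_eq_conv μ h0 (he.1 j) (hl j (by simp)), charFun_conv, norm_mul,
      Finset.prod_insert hj]
    refine mul_le_mul ?_ ?_ (norm_nonneg _) (by positivity)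
    · simpa [hl0 j] using norm_charFun_sqGaussian_le (l j).toNNReal (inner ℝ (e j) b) t
    · refine ih (μ.map (dropDir (e j))) (integral_map_dropDir μ h0 _) (fun i hi => ?_) _
      have hij : inner ℝ (e j) (e i) = 0 := he.2 (fun h => hj (h ▸ hi))
      rw [covarianceOperator_map_dropDir μ _ _ hij, hl i (by simp [hi]), map_smul,
        dropDir_of_inner_eq_zero hij]

variable (μ : Measure H) [IsGaussian μ]

lemma exists_normSqLaw_add_smul (h0 : ∫ z, z ∂μ = 0) {e : H} (he : ‖e‖ = 1) {l : ℝ}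
    (hl : covarianceOperator μ e = l • e) {b : H} (hb : inner ℝ e b = 0) (c : ℝ) :
    ∃ ν : Measure ℝ, IsProbabilityMeasure ν ∧ (∀ᵐ x ∂ν, 0 ≤ x) ∧
      ∫⁻ x, ENNReal.ofReal x ∂ν ≤ ENNReal.ofReal (c ^ 2) ∧
      normSqLaw μ (b + c • e) = normSqLaw μ b ∗ ν := by
  obtain ⟨ν, h1, h2, h3, h4⟩ := exists_sqGaussian_eq_conv l.toNNReal c
  refine ⟨ν, h1, h2, h3, ?_⟩
  rw [normSqLaw_eq_conv μ h0 he hl, normSqLaw_eq_conv μ h0 he hl b, inner_add_right, hb,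
    real_inner_smul_right, real_inner_self_eq_norm_sq, he, map_add, map_smul, dropDir_self he]
  simp only [smul_zero, add_zero, zero_add, one_pow, mul_one]
  rw [h4, Measure.conv_assoc, Measure.conv_comm ν, ← Measure.conv_assoc]

/-- Shifts along distinct eigenvectors alter different independent summands, so the added
nonnegative variables are independent and the bounds on their means add up. -/
lemma exists_normSqLaw_sum (h0 : ∫ z, z ∂μ = 0) {ι : Type*} {e : ι → H} (he : Orthonormal ℝ e)
    {l : ι → ℝ} (hl : ∀ i, covarianceOperator μ (e i) = l i • e i) (c : ι → ℝ) (s : Finset ι) :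
    ∃ ν : Measure ℝ, IsProbabilityMeasure ν ∧ (∀ᵐ x ∂ν, 0 ≤ x) ∧
      ∫⁻ x, ENNReal.ofReal x ∂ν ≤ ENNReal.ofReal (∑ i ∈ s, c i ^ 2) ∧
      normSqLaw μ (∑ i ∈ s, c i • e i) = normSqLaw μ 0 ∗ ν := by
  classical
  induction s using Finset.induction_on with
  | empty =>
    refine ⟨Measure.dirac 0, inferInstance, ?_, by simp, by simp⟩
    rw [ae_dirac_iff measurableSet_Ici]
  | insert j s hj ih =>
    obtain ⟨ν, h1, h2, h3, h4⟩ := ih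
    have hb : inner ℝ (e j) (∑ i ∈ s, c i • e i) = 0 := by
      rw [inner_sum]
      refine Finset.sum_eq_zero fun i hi => ?_
      rw [real_inner_smul_right, he.2 (fun h : j = i => hj (h ▸ hi)), mul_zero]
    obtain ⟨κ, k1, k2, k3, k4⟩ := exists_normSqLaw_add_smul μ h0 (he.1 j) (hl j) hb (c j)
    refine ⟨ν ∗ κ, inferInstance, conv_nonneg h2 k2, ?_, ?_⟩
    · refine lintegral_conv_le.trans ?_
      rw [Finset.sum_insert hj, add_comm (c j ^ 2),
        ENNReal.ofReal_add (Finset.sum_nonneg fun i _ => sq_nonneg _) (sq_nonneg _)]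
      gcongr
    · rw [Finset.sum_insert hj, add_comm, k4, h4, Measure.conv_assoc]

/-- Shifting the centre of a ball by `b` changes its probability by at most the
anti-concentration constant times the squared norm of `b`. -/
lemma normSqLaw_Iic_shift (h0 : ∫ z, z ∂μ = 0) {ι : Type*} (e : HilbertBasis ι ℝ H)
    {l : ι → ℝ} (hl : ∀ i, covarianceOperator μ (e i) = l i • e i) {K : ℝ≥0∞}
    (hK : AntiConc (normSqLaw μ 0) K) (b : H) {x : ℝ} (hx : 0 ≤ x) :
    normSqLaw μ b (Set.Iic x) ≤ normSqLaw μ 0 (Set.Iic x) ∧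
      normSqLaw μ 0 (Set.Iic x) ≤
        normSqLaw μ b (Set.Iic x) + K * ENNReal.ofReal (‖b‖ ^ 2) := by
  have hfin : ∀ (s : Finset ι) (y : ℝ),
      normSqLaw μ (∑ i ∈ s, inner ℝ (e i) b • e i) (Set.Iic y) ≤ normSqLaw μ 0 (Set.Iic y) ∧
      normSqLaw μ 0 (Set.Iic y) ≤
        normSqLaw μ (∑ i ∈ s, inner ℝ (e i) b • e i) (Set.Iic y) +
          K * ENNReal.ofReal (‖b‖ ^ 2) := by
    intro s y
    obtain ⟨ν, h1, h2, h3, h4⟩ :=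
      exists_normSqLaw_sum μ h0 e.orthonormal hl (fun i => inner ℝ (e i) b) s
    rw [h4]
    obtain ⟨h5, h6⟩ := hK.conv_Iic h2 y
    refine ⟨h5, h6.trans ?_⟩
    gcongr
    refine h3.trans (ENNReal.ofReal_le_ofReal ?_)
    have := e.orthonormal.sum_inner_products_le (x := b) (s := s)
    simpa using this
  have hlim : Filter.Tendsto (fun s : Finset ι => ∑ i ∈ s, inner ℝ (e i) b • e i) Filter.atTop
      (nhds b) := by
    have := e.hasSum_repr b
    simp_rw [e.repr_apply_apply] at this
    exact this
  have hclose : ∀ δ > 0, ∃ s : Finset ι, ‖∑ i ∈ s, inner ℝ (e i) b • e i - b‖ < δ := by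
    intro δ hδ
    exact ((Metric.tendsto_nhds.1 hlim δ hδ).exists).imp fun s hs => by rwa [dist_eq_norm] at hs
  -- The finite expansions of `b` converge to `b`. Changing the centre is paid for by a slightly
  -- larger level `y > x`, and right continuity of the distribution function lets `y` decrease to
  -- `x`.
  constructor
  · refine ge_of_tendsto (tendsto_measure_Iic_right (normSqLaw μ 0) x) ?_
    filter_upwards [self_mem_nhdsWithin] with y hy
    obtain ⟨δ, hδ, h⟩ := exists_normSqLaw_Iic_le μ b hx hy
    obtain ⟨s, hs⟩ := hclose δ hδ
    exact (h b _ (by simpa using hδ) hs).trans (hfin s y).1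
  · refine ge_of_tendsto ((tendsto_measure_Iic_right (normSqLaw μ b) x).add_const _) ?_
    filter_upwards [self_mem_nhdsWithin] with y hy
    obtain ⟨δ, hδ, h⟩ := exists_normSqLaw_Iic_le μ b hx hy
    obtain ⟨s, hs⟩ := hclose δ hδ
    refine (hfin s x).2.trans ?_
    exact add_le_add_left (h _ b hs (by simpa using hδ)) _

/-- Adding independent noise to a centred Gaussian element changes the probabilities of centred
balls by at most the anti-concentration constant times the second moment of the noise. -/
lemma normSqLaw_conv_Iic (h0 : ∫ z, z ∂μ = 0) {ι : Type*} (e : HilbertBasis ι ℝ H)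
    {l : ι → ℝ} (hl : ∀ i, covarianceOperator μ (e i) = l i • e i) {K : ℝ≥0∞}
    (hK : AntiConc (normSqLaw μ 0) K) (γ : Measure H) [IsProbabilityMeasure γ]
    {x : ℝ} (hx : 0 ≤ x) :
    normSqLaw (μ ∗ γ) 0 (Set.Iic x) ≤ normSqLaw μ 0 (Set.Iic x) ∧
      normSqLaw μ 0 (Set.Iic x) ≤
        normSqLaw (μ ∗ γ) 0 (Set.Iic x) + K * ∫⁻ g, ENNReal.ofReal (‖g‖ ^ 2) ∂γ := by
  have hA : MeasurableSet ((fun z : H => ‖z - 0‖ ^ 2) ⁻¹' Set.Iic x) :=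
    measurableSet_Iic.preimage (by fun_prop)
  -- Conditionally on the noise `g`, the centred ball becomes the ball with centre `-g`.
  have hconv : normSqLaw (μ ∗ γ) 0 (Set.Iic x) = ∫⁻ g, normSqLaw μ (-g) (Set.Iic x) ∂γ := by
    rw [normSqLaw, Measure.map_apply (by fun_prop) measurableSet_Iic, conv_apply_eq_lintegral hA]
    congr 1; ext g
    rw [normSqLaw, Measure.map_apply (by fun_prop) measurableSet_Iic]
    congr 1; ext z; simp
  rw [hconv]
  have hs := fun g : H => normSqLaw_Iic_shift μ h0 e hl hK (-g) hx
  simp only [norm_neg] at hs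
  constructor
  · calc _ ≤ ∫⁻ g, normSqLaw μ 0 (Set.Iic x) ∂γ := lintegral_mono fun g => (hs g).1
      _ = _ := by simp
  · calc _ = ∫⁻ g, normSqLaw μ 0 (Set.Iic x) ∂γ := by simp
      _ ≤ ∫⁻ g, (normSqLaw μ (-g) (Set.Iic x) + K * ENNReal.ofReal (‖g‖ ^ 2)) ∂γ :=
        lintegral_mono fun g => (hs g).2
      _ = _ := by
        rw [lintegral_add_right _ (by fun_prop), lintegral_const_mul _ (by fun_prop)]

end Shift

/-! ### Spectral theory of Gaussian covariance operators -/

lemma countable_of_orthonormal {H : Type*} [NormedAddCommGroup H] [InnerProductSpace ℝ H]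
    [TopologicalSpace.SeparableSpace H] {ι : Type*} {e : ι → H} (he : Orthonormal ℝ e) :
    Countable ι := by
  refine Pairwise.countable_of_isOpen_disjoint (s := fun i => Metric.ball (e i) (1 / 2)) ?_
    (fun i => Metric.isOpen_ball) (fun i => ⟨e i, Metric.mem_ball_self (by norm_num)⟩)
  intro i j hij
  refine Metric.ball_disjoint_ball ?_
  have h : dist (e i) (e j) ^ 2 = 2 := by
    rw [dist_eq_norm, norm_sub_sq_real, he.2 hij, he.1, he.1]; norm_num
  nlinarith [dist_nonneg (x := e i) (y := e j)]

/-- A compact symmetric operator has a Hilbert basis of eigenvectors. -/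
lemma exists_hilbertBasis_eigenvectors {H : Type u} [NormedAddCommGroup H] [InnerProductSpace ℝ H]
    [CompleteSpace H] {T : H →L[ℝ] H} (hT : IsCompactOperator T)
    (hT' : (T : H →ₗ[ℝ] H).IsSymmetric) :
    ∃ (ι : Type u) (e : HilbertBasis ι ℝ H) (l : ι → ℝ), ∀ i, T (e i) = l i • e i := by
  have hc : ∀ ν : ℝ, CompleteSpace (eigenspace T ν) := fun ν => by
    have : IsClosed (eigenspace T ν : Set H) := by
      have h : (eigenspace T ν : Set H) = {x | T x = ν • x} := by
        ext x; simp [eigenspace]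
      rw [h]
      exact isClosed_eq T.continuous (continuous_const_smul ν)
    exact this.completeSpace_coe
  choose w b hb using fun ν : ℝ => exists_hilbertBasis ℝ (eigenspace T ν)
  have horth : Orthonormal ℝ fun a : Σ ν, w ν => ((b a.1 a.2 : eigenspace T a.1) : H) :=
    OrthogonalFamily.orthonormal_sigma_orthonormal (𝕜 := ℝ)
      (V := fun ν => (eigenspace T ν).subtypeₗᵢ) hT'.orthogonalFamily_eigenspaces
      (v_family := fun ν i => b ν i) (fun ν => (b ν).orthonormal)
  refine ⟨Σ ν, w ν, HilbertBasis.mkOfOrthogonalEqBot horth ?_, fun a => a.1, fun a => ?_⟩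
  -- A vector orthogonal to the chosen bases is orthogonal to every eigenspace, the kernel included,
  -- hence zero by the spectral theorem.
  · rw [eq_bot_iff, ← ContinuousLinearMap.orthogonalComplement_iSup_eigenspaces_eq_bot hT hT']
    intro x hx
    rw [Submodule.mem_orthogonal] at hx ⊢
    intro u hu
    refine Submodule.iSup_induction _ (motive := fun u => inner ℝ u x = 0) hu ?_ (by simp) ?_
    · intro ν u hu
      have h1 := (b ν).hasSum_repr ⟨u, hu⟩
      have h2 : HasSum (fun i => inner ℝ (((b ν).repr ⟨u, hu⟩ i • b ν i : eigenspace T ν) : H) x)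
          (inner ℝ u x) := by
        have := h1.mapL ((innerSL ℝ x).comp (eigenspace T ν).subtypeL)
        simpa [real_inner_comm, real_inner_smul_right] using this
      have h3 : ∀ i, inner ℝ (((b ν).repr ⟨u, hu⟩ i • b ν i : eigenspace T ν) : H) x = 0 := by
        intro i
        rw [Submodule.coe_smul, real_inner_smul_left,
          hx _ (Submodule.subset_span ⟨⟨ν, i⟩, rfl⟩), mul_zero]
      simp_rw [h3] at h2
      exact h2.unique hasSum_zero
    · intro u v hu hv
      rw [inner_add_left, hu, hv, add_zero]
  · rw [HilbertBasis.coe_mkOfOrthogonalEqBot]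
    exact Module.End.mem_eigenspace_iff.1 (b a.1 a.2).2

section Compact

variable {H : Type*} [NormedAddCommGroup H] [InnerProductSpace ℝ H] [CompleteSpace H]
  [SecondCountableTopology H] [MeasurableSpace H] [BorelSpace H] (μ : Measure H) [IsGaussian μ]

lemma integrable_norm_sq : Integrable (fun z => ‖z‖ ^ 2) μ :=
  IsGaussian.memLp_two_id.integrable_norm_pow (by norm_num)

/-- A norm limit of finite-rank operators: with finite-dimensional projections `P s`, the norm of `Σ
- P s Σ` is at most the integral of `‖y‖ ‖y - P s y‖`, which tends to zero by dominated convergence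
with majorant `2 ‖y‖ ^ 2`. -/
lemma isCompactOperator_covarianceOperator : IsCompactOperator (covarianceOperator μ) := by
  obtain ⟨w, b, -⟩ := exists_hilbertBasis ℝ H
  have := countable_of_orthonormal b.orthonormal
  let P : Finset w → H →L[ℝ] H := fun s => ∑ i ∈ s, (innerSL ℝ (b i)).smulRight (b i)
  have hP : ∀ s y, P s y = ∑ i ∈ s, inner ℝ (b i) y • b i := fun s y => by
    simp [P]
  have hPn : ∀ s y, ‖P s y‖ ≤ ‖y‖ := fun s y => by
    have h1 : ‖P s y‖ ^ 2 = ∑ i ∈ s, (inner ℝ (b i) y) ^ 2 := by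
      rw [hP, ← real_inner_self_eq_norm_sq, b.orthonormal.inner_sum]
      simp [sq]
    have h2 := b.orthonormal.sum_inner_products_le (x := y) (s := s)
    simp only [Real.norm_eq_abs, sq_abs] at h2
    rw [← h1] at h2
    exact (sq_le_sq₀ (norm_nonneg _) (norm_nonneg _)).1 h2
  have hPlim : ∀ y, Filter.Tendsto (fun s => P s y) Filter.atTop (nhds y) := fun y => by
    have := b.hasSum_repr y
    simp_rw [b.repr_apply_apply] at this
    simp_rw [hP]
    exact this
  have hlim : Filter.Tendsto (fun s => ∫ y, ‖y‖ * ‖y - P s y‖ ∂μ) Filter.atTop (nhds 0) := by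
    rw [← integral_zero H ℝ (μ := μ)]
    refine tendsto_integral_filter_of_dominated_convergence (fun y => 2 * ‖y‖ ^ 2)
      (Filter.Eventually.of_forall fun s => by fun_prop)
      (Filter.Eventually.of_forall fun s => Filter.Eventually.of_forall fun y => ?_)
      ((integrable_norm_sq μ).const_mul 2) (Filter.Eventually.of_forall fun y => ?_)
    · rw [Real.norm_of_nonneg (by positivity)]
      have := norm_sub_le y (P s y)
      have := hPn s y
      nlinarith [norm_nonneg y]
    · have := ((hPlim y).const_sub y).norm.const_mul ‖y‖
      simpa using this
  have hmem := IsGaussian.memLp_two_id (μ := μ)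
  refine isCompactOperator_of_tendsto (l := Filter.atTop)
    (F := fun s => (P s).comp (covarianceOperator μ)) ?_ (Filter.Eventually.of_forall fun s => ?_)
  · rw [tendsto_iff_norm_sub_tendsto_zero]
    refine squeeze_zero (fun s => norm_nonneg _) (fun s => ?_) hlim
    rw [norm_sub_rev]
    refine ContinuousLinearMap.opNorm_le_bound _ (integral_nonneg fun y => by positivity)
      fun z => ?_
    have hint : Integrable (fun y => inner ℝ z y • y) μ :=
      memLp_one_iff_integrable.1 <| hmem.smul (hmem.const_inner z)
    have h1 : (covarianceOperator μ - (P s).comp (covarianceOperator μ)) z =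
        ∫ y, inner ℝ z y • (y - P s y) ∂μ := by
      rw [sub_apply, ContinuousLinearMap.comp_apply,
        covarianceOperator_apply hmem, ← ContinuousLinearMap.integral_comp_comm _ hint,
        ← integral_sub hint ((P s).integrable_comp hint)]
      simp [smul_sub]
    rw [h1, mul_comm, ← integral_const_mul]
    refine norm_integral_le_of_norm_le ?_ (Filter.Eventually.of_forall fun y => ?_)
    · refine Integrable.const_mul ?_ _
      refine ((integrable_norm_sq μ).const_mul 2).mono' (by fun_prop)
        (Filter.Eventually.of_forall fun y => ?_)
      rw [Real.norm_of_nonneg (by positivity)]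
      have := norm_sub_le y (P s y)
      have := hPn s y
      nlinarith [norm_nonneg y]
    · rw [norm_smul, ← mul_assoc]
      gcongr
      exact norm_inner_le_norm z y
  · have hsum : IsCompactOperator (P s) := by
      have : ∀ s : Finset w, P s ∈ compactOperator (RingHom.id ℝ) H H := fun s =>
        Submodule.sum_mem _ fun i _ => by
          have h1 : IsCompactOperator (innerSL ℝ (b i)) :=
            (isCompactOperator_id (E := ℝ)).comp_clm (innerSL ℝ (b i))
          exact h1.clm_comp (ContinuousLinearMap.toSpanSingleton ℝ (b i : H))
      exact this s
    exact hsum.comp_clm (covarianceOperator μ)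

/-- Integrating Bessel's inequality bounds every partial trace by the second moment of `μ`. -/
lemma summable_inner_covarianceOperator {ι : Type*} {e : ι → H} (he : Orthonormal ℝ e) :
    Summable fun i => inner ℝ (covarianceOperator μ (e i)) (e i) := by
  refine summable_of_sum_le (c := ∫ z, ‖z‖ ^ 2 ∂μ)
    (fun i => isPositive_covarianceOperator.2 (e i)) fun s => ?_
  simp_rw [inner_covarianceOperator]
  rw [← integral_finsetSum]
  · refine integral_mono (integrable_finsetSum _ fun i _ => ?_) (integrable_norm_sq μ) fun z => ?_
    · exact (memLp_inner μ (e i)).integrable_mul (memLp_inner μ (e i))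
    · have := he.sum_inner_products_le (x := z) (s := s)
      simpa [sq] using this
  · exact fun i _ => (memLp_inner μ (e i)).integrable_mul (memLp_inner μ (e i))

end Compact

/-! ### Gaussian noise with prescribed diagonal covariance -/

section Diagonal

variable {H : Type*} [NormedAddCommGroup H] [InnerProductSpace ℝ H]
  [SecondCountableTopology H] [MeasurableSpace H] [BorelSpace H]

lemma charFun_infinitePi_sum {ι : Type*} (c : ι → ℝ) (s : Finset ι) :
    ∫ ω, Complex.exp (((∑ i ∈ s, c i * ω i : ℝ) : ℂ) * Complex.I)
      ∂(Measure.infinitePi fun _ : ι => gaussianReal 0 1) =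
    Complex.exp (-((∑ i ∈ s, c i ^ 2 : ℝ) : ℂ) / 2) := by
  set P := Measure.infinitePi fun _ : ι => gaussianReal 0 1
  have hind : iIndepFun (fun (i : ι) (ω : ι → ℝ) => c i * ω i) P :=
    iIndepFun_infinitePi (P := fun _ : ι => gaussianReal 0 1) (X := fun i x => c i * x)
      (fun i => by fun_prop)
  have h := iIndepFun.charFun_map_fun_finsetSum_eq_prod (X := fun (i : ι) (ω : ι → ℝ) => c i * ω i)
    (s := s) (P := P) (fun i _ => (by fun_prop : Measurable _).aemeasurable) (hind.restrict s)
  have hmap : ∀ i, P.map (fun ω => c i * ω i) = (gaussianReal 0 1).map (fun x => c i * x) := by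
    intro i
    rw [← Measure.infinitePi_map_eval (fun _ : ι => gaussianReal 0 1) i,
      Measure.map_map (by fun_prop) (by fun_prop)]
    rfl
  have h1 := congrFun h 1
  rw [charFun_apply_real, integral_map (by fun_prop : Measurable _).aemeasurable (by fun_prop)] at h1
  simp only [Complex.ofReal_one, one_mul] at h1
  rw [h1]
  simp only [hmap, Finset.prod_apply, charFun_map_mul, charFun_gaussianReal]
  rw [← Complex.exp_sum]
  congr 1
  push_cast
  rw [← Finset.sum_neg_distrib, Finset.sum_div]
  refine Finset.sum_congr rfl fun i _ => ?_
  simp [neg_div]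

/-- A centred Gaussian measure that is diagonal in a Hilbert basis, with summable variances. -/
lemma exists_diagonal_measure {ι : Type*} (e : HilbertBasis ι ℝ H) {d : ι → ℝ} (hd : ∀ i, 0 ≤ d i)
    (hs : Summable d) :
    ∃ γ : Measure H, IsProbabilityMeasure γ ∧
      (∫⁻ g, ENNReal.ofReal (‖g‖ ^ 2) ∂γ ≤ ∑' i, ENNReal.ofReal (d i)) ∧
      ∀ x, charFun γ x = Complex.exp (-((∑' i, d i * inner ℝ (e i) x ^ 2 : ℝ) : ℂ) / 2) := by
  have hcount := countable_of_orthonormal e.orthonormal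
  set P := Measure.infinitePi fun _ : ι => gaussianReal 0 1 with hP
  -- The expected sum of squared coefficients is the trace. Being finite, it makes the random series
  -- with coefficients `√(d i) * ω i` converge almost surely.
  have hlint : ∫⁻ ω, ∑' i, ENNReal.ofReal (d i * ω i ^ 2) ∂P = ∑' i, ENNReal.ofReal (d i) := by
    rw [lintegral_tsum (fun i => (by fun_prop : Measurable _).aemeasurable)]
    congr 1; ext i
    have h1 : ∫⁻ ω, ENNReal.ofReal (d i * ω i ^ 2) ∂P =
        ∫⁻ x, ENNReal.ofReal (d i * x ^ 2) ∂(gaussianReal 0 1) := by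
      rw [← Measure.infinitePi_map_eval (fun _ : ι => gaussianReal 0 1) i,
        lintegral_map (by fun_prop) (by fun_prop)]
    have h2 : ∫ x, x ^ 2 ∂(gaussianReal 0 1) = 1 := by
      have := variance_fun_id_gaussianReal (μ := 0) (v := 1)
      rw [variance_eq_integral (by fun_prop)] at this
      simpa using this
    have h3 : Integrable (fun x : ℝ => x ^ 2) (gaussianReal 0 1) := by
      have := (memLp_id_gaussianReal (μ := 0) (v := 1) 2).integrable_sq
      simpa using this
    rw [h1]
    simp_rw [ENNReal.ofReal_mul (hd i)]
    rw [lintegral_const_mul _ (by fun_prop),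
      ← ofReal_integral_eq_lintegral_ofReal h3 (Filter.Eventually.of_forall fun x => sq_nonneg x),
      h2]
    simp
  have hfin : ∑' i, ENNReal.ofReal (d i) ≠ ∞ := by
    rw [← ENNReal.ofReal_tsum_of_nonneg hd hs]; exact ENNReal.ofReal_ne_top
  have hae : ∀ᵐ ω ∂P, ∑' i, ENNReal.ofReal (d i * ω i ^ 2) < ∞ :=
    ae_lt_top (by fun_prop) (hlint ▸ hfin)
  have hsumm : ∀ᵐ ω ∂P, HasSum (fun i => (√(d i) * ω i) • e i) (∑' i, (√(d i) * ω i) • e i) ∧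
      ENNReal.ofReal (‖∑' i, (√(d i) * ω i) • e i‖ ^ 2) =
        ∑' i, ENNReal.ofReal (d i * ω i ^ 2) := by
    filter_upwards [hae] with ω hω
    have hsq : ∀ i, (√(d i) * ω i) ^ 2 = d i * ω i ^ 2 := fun i => by
      rw [mul_pow, Real.sq_sqrt (hd i)]
    have hS : Summable fun i => d i * ω i ^ 2 := by
      have := ENNReal.summable_toReal hω.ne
      refine this.congr fun i => ENNReal.toReal_ofReal (mul_nonneg (hd i) (sq_nonneg _))
    have hmem : Memℓp (fun i => √(d i) * ω i) 2 := by
      rw [memℓp_gen_iff (by norm_num)]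
      simp only [ENNReal.toReal_ofNat, Real.rpow_ofNat, Real.norm_eq_abs, sq_abs, hsq]
      exact hS
    let f : lp (fun _ : ι => ℝ) 2 := ⟨fun i => √(d i) * ω i, hmem⟩
    have hf := e.hasSum_repr_symm f
    have hf' : HasSum (fun i => (√(d i) * ω i) • e i) (e.repr.symm f) := hf
    refine ⟨hf'.summable.hasSum, ?_⟩
    rw [hf'.tsum_eq, LinearIsometryEquiv.norm_map, ← ENNReal.ofReal_tsum_of_nonneg
      (fun i => mul_nonneg (hd i) (sq_nonneg _)) hS]
    congr 1
    have := lp.norm_rpow_eq_tsum (p := 2) (by norm_num) f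
    simp only [ENNReal.toReal_ofNat, Real.rpow_ofNat, Real.norm_eq_abs, sq_abs] at this
    rw [this]
    exact tsum_congr hsq
  have hmeas : AEMeasurable (fun ω : ι → ℝ => ∑' i, (√(d i) * ω i) • e i) P := by
    refine aemeasurable_of_tendsto_metrizable_ae Filter.atTop
      (f := fun (s : Finset ι) ω => ∑ i ∈ s, (√(d i) * ω i) • e i)
      (fun s => (by fun_prop : Measurable _).aemeasurable) ?_
    filter_upwards [hsumm] with ω hω using hω.1
  refine ⟨P.map fun ω => ∑' i, (√(d i) * ω i) • e i, Measure.isProbabilityMeasure_map hmeas, ?_, ?_⟩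
  · rw [lintegral_map' (by fun_prop) hmeas, ← hlint]
    refine lintegral_mono_ae ?_
    filter_upwards [hsumm] with ω hω using hω.2.le
  · intro x
    rw [charFun_apply, integral_map hmeas (by fun_prop)]
    have hsx : Summable fun i => d i * inner ℝ (e i) x ^ 2 := by
      refine Summable.of_nonneg_of_le (fun i => mul_nonneg (hd i) (sq_nonneg _)) (fun i => ?_)
        (hs.mul_right (‖x‖ ^ 2))
      have h1 := abs_real_inner_le_norm (e i) x
      rw [e.orthonormal.1 i, one_mul] at h1
      have h2 : inner ℝ (e i) x ^ 2 ≤ ‖x‖ ^ 2 := by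
        rw [← sq_abs]; gcongr
      exact mul_le_mul_of_nonneg_left h2 (hd i)
    have hl1 : Filter.Tendsto (fun s : Finset ι => ∫ ω, Complex.exp
        (((∑ i ∈ s, (√(d i) * inner ℝ (e i) x) * ω i : ℝ) : ℂ) * Complex.I) ∂P) Filter.atTop
        (nhds (∫ ω, Complex.exp (((inner ℝ (∑' i, (√(d i) * ω i) • e i) x : ℝ) : ℂ) *
          Complex.I) ∂P)) := by
      refine tendsto_integral_filter_of_dominated_convergence (fun _ => 1)
        (Filter.Eventually.of_forall fun s => (by fun_prop : Measurable _).aestronglyMeasurable)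
        (Filter.Eventually.of_forall fun s => Filter.Eventually.of_forall fun ω => ?_)
        (integrable_const _) ?_
      · rw [Complex.norm_exp_ofReal_mul_I]
      · filter_upwards [hsumm] with ω hω
        have h1 : Filter.Tendsto (fun s : Finset ι => inner ℝ (∑ i ∈ s, (√(d i) * ω i) • e i) x)
            Filter.atTop (nhds (inner ℝ (∑' i, (√(d i) * ω i) • e i) x)) :=
          Filter.Tendsto.inner hω.1 tendsto_const_nhds
        have h2 : ∀ s : Finset ι, inner ℝ (∑ i ∈ s, (√(d i) * ω i) • e i) x =
            ∑ i ∈ s, (√(d i) * inner ℝ (e i) x) * ω i := fun s => by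
          rw [sum_inner]
          refine Finset.sum_congr rfl fun i _ => ?_
          rw [real_inner_smul_left]; ring
        simp_rw [h2] at h1
        exact (Complex.continuous_exp.tendsto _).comp
          (((Complex.continuous_ofReal.tendsto _).comp h1).mul_const Complex.I)
    simp_rw [hP, charFun_infinitePi_sum] at hl1
    refine tendsto_nhds_unique hl1 ?_
    have h3 : ∀ i, (√(d i) * inner ℝ (e i) x) ^ 2 = d i * inner ℝ (e i) x ^ 2 := fun i => by
      rw [mul_pow, Real.sq_sqrt (hd i)]
    simp_rw [h3]
    have h4 : Filter.Tendsto (fun s : Finset ι => ∑ i ∈ s, d i * inner ℝ (e i) x ^ 2) Filter.atTop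
        (nhds (∑' i, d i * inner ℝ (e i) x ^ 2)) := hsx.hasSum
    exact (Complex.continuous_exp.tendsto _).comp
      ((((Complex.continuous_ofReal.tendsto _).comp h4).neg).div_const 2)

end Diagonal

/-! ### Ordered eigenvalues read off from an eigenbasis -/

section Eigenvalues

variable {H : Type*} [NormedAddCommGroup H] [InnerProductSpace ℝ H] {T : H →L[ℝ] H}

lemma inner_eq_zero_of_mem_eigenspace (hT : (T : H →ₗ[ℝ] H).IsSymmetric) {e x : H} {l ν : ℝ}
    (he : T e = l • e) (hx : x ∈ eigenspace T ν) (h : l ≠ ν) : inner ℝ e x = 0 := by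
  have h1 : T x = ν • x := Module.End.mem_eigenspace_iff.1 hx
  have h2 : inner ℝ (T e) x = inner ℝ e (T x) := hT e x
  rw [he, h1, real_inner_smul_left, real_inner_smul_right] at h2
  have h3 : (l - ν) * inner ℝ e x = 0 := by linarith
  exact (mul_eq_zero.1 h3).resolve_left (sub_ne_zero.2 h)

variable {ι : Type*} (e : HilbertBasis ι ℝ H) {l : ι → ℝ}

/-- In the expansion of an eigenvector for `ν ≥ t` only basis vectors with the same eigenvalue
survive, and these are indexed by `s`. -/
lemma rank_iSup_eigenspace_le (hT : (T : H →ₗ[ℝ] H).IsSymmetric) (hl : ∀ i, T (e i) = l i • e i)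
    {t : ℝ} {s : Finset ι} (hs : ∀ i, i ∈ s ↔ t ≤ l i) :
    Module.rank ℝ ↥(⨆ ν ∈ Set.Ici t, eigenspace T ν) ≤ s.card := by
  classical
  have hle : (⨆ ν ∈ Set.Ici t, eigenspace T ν) ≤
      Submodule.span ℝ ((s.image e : Finset H) : Set H) := by
    refine iSup₂_le fun ν hν x hx => ?_
    have h1 : HasSum (fun i => inner ℝ (e i) x • e i) x := by
      have := e.hasSum_repr x
      simp_rw [e.repr_apply_apply] at this
      exact this
    have h2 : ∑ i ∈ s, inner ℝ (e i) x • e i = x := by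
      refine (hasSum_sum_of_ne_finset_zero fun i hi => ?_).unique h1
      rw [inner_eq_zero_of_mem_eigenspace hT (hl i) hx, zero_smul]
      rintro rfl
      exact hi ((hs i).2 hν)
    rw [← h2]
    refine Submodule.sum_mem _ fun i hi => Submodule.smul_mem _ _ (Submodule.subset_span ?_)
    exact Finset.mem_coe.2 (Finset.mem_image_of_mem _ hi)
  refine (Submodule.rank_mono hle).trans ((rank_span_finset_le _).trans ?_)
  exact_mod_cast Finset.card_image_le

lemma card_le_rank_iSup_eigenspace {e : ι → H} (he : Orthonormal ℝ e)
    (hl : ∀ i, T (e i) = l i • e i) {A : Set ℝ} {s : Finset ι} (hs : ∀ i ∈ s, l i ∈ A) :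
    (s.card : Cardinal) ≤ Module.rank ℝ ↥(⨆ ν ∈ A, eigenspace T ν) := by
  let f : s → ↥(⨆ ν ∈ A, eigenspace T ν) := fun i => ⟨e i, by
    have h1 : eigenspace T (l i) ≤ ⨆ ν ∈ A, eigenspace T ν :=
      le_iSup₂_of_le (l i) (hs i i.2) le_rfl
    exact h1 (Module.End.mem_eigenspace_iff.2 (hl i))⟩
  have hf : LinearIndependent ℝ f := by
    refine LinearIndependent.of_comp (Submodule.subtype _) ?_
    exact he.linearIndependent.comp (fun i : s => (i : ι)) Subtype.val_injective
  have := hf.cardinal_lift_le_rank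
  simpa using this

lemma finite_le_of_summable (hsum : Summable l) {t : ℝ} (ht : 0 < t) : {i | t ≤ l i}.Finite := by
  have h := hsum.tendsto_cofinite_zero.eventually (gt_mem_nhds ht)
  rw [Filter.eventually_cofinite] at h
  simpa using h

lemma exists_finset_of_le_rank (hT : (T : H →ₗ[ℝ] H).IsSymmetric) (hl : ∀ i, T (e i) = l i • e i)
    (hsum : Summable l)
    {t : ℝ} (ht : 0 < t) {k : ℕ}
    (h : (k : Cardinal) ≤ Module.rank ℝ ↥(⨆ ν ∈ Set.Ici t, eigenspace T ν)) :
    ∃ s : Finset ι, s.card = k ∧ ∀ i ∈ s, t ≤ l i := by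
  have h1 := h.trans (rank_iSup_eigenspace_le e hT hl
    (s := (finite_le_of_summable hsum ht).toFinset) (by simp))
  obtain ⟨s, hs, hc⟩ := Finset.exists_subset_card_eq (Nat.cast_le.1 h1)
  exact ⟨s, hc, fun i hi => by simpa using hs hi⟩

lemma bddAbove_eigenvalue_set (hT : (T : H →ₗ[ℝ] H).IsSymmetric) (hl : ∀ i, T (e i) = l i • e i)
    (hl0 : ∀ i, 0 ≤ l i) (hsum : Summable l)
    (k : ℕ) :
    BddAbove {t : ℝ | 0 < t ∧
      ((k + 1 : ℕ) : Cardinal) ≤ Module.rank ℝ ↥(⨆ ν ∈ Set.Ici t, eigenspace T ν)} := by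
  refine ⟨∑' i, l i, ?_⟩
  rintro t ⟨ht, hr⟩
  obtain ⟨s, hc, hs⟩ := exists_finset_of_le_rank e hT hl hsum ht hr
  obtain ⟨i, hi⟩ := Finset.card_pos.1 (by omega : 0 < s.card)
  exact (hs i hi).trans (hsum.le_tsum i fun j _ => hl0 j)

lemma eigenvalue_nonneg (T : H →L[ℝ] H) (k : ℕ) : 0 ≤ eigenvalue T k :=
  Real.sSup_nonneg fun _ ht => ht.1.le

lemma le_eigenvalue (hT : (T : H →ₗ[ℝ] H).IsSymmetric) (hl : ∀ i, T (e i) = l i • e i)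
    (hl0 : ∀ i, 0 ≤ l i) (hsum : Summable l)
    {k : ℕ} {t : ℝ} {s : Finset ι} (hc : s.card = k + 1) (hs : ∀ i ∈ s, t ≤ l i) :
    t ≤ eigenvalue T k := by
  rcases le_or_gt t 0 with ht | ht
  · exact ht.trans (eigenvalue_nonneg T k)
  refine le_csSup (bddAbove_eigenvalue_set e hT hl hl0 hsum k) ⟨ht, ?_⟩
  rw [← hc]
  exact card_le_rank_iSup_eigenspace e.orthonormal hl hs

/-- The supremum is attained: only finitely many `l i` are at least `x / 2`, so some `m < x` exceeds
all of those below `x`, and any admissible level above `m` yields indices with `l i ≥ x`. -/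
lemma exists_finset_eigenvalue_le (hT : (T : H →ₗ[ℝ] H).IsSymmetric) (hl : ∀ i, T (e i) = l i • e i)
    (hsum : Summable l)
    {k : ℕ} (hk : 0 < eigenvalue T k) :
    ∃ s : Finset ι, s.card = k + 1 ∧ ∀ i ∈ s, eigenvalue T k ≤ l i := by
  set x := eigenvalue T k with hx
  have hfin := finite_le_of_summable hsum (half_pos hk)
  have hev : ∀ᶠ m in nhdsWithin x (Set.Iio x), ∀ i ∈ hfin.toFinset, l i < x → l i < m := by
    rw [Filter.eventually_all_finset]
    intro i _
    by_cases h : l i < x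
    · filter_upwards [mem_nhdsWithin_of_mem_nhds (lt_mem_nhds h)] with m hm _ using hm
    · exact Filter.Eventually.of_forall fun m h' => absurd h' h
  have hev2 : ∀ᶠ m in nhdsWithin x (Set.Iio x), x / 2 < m :=
    mem_nhdsWithin_of_mem_nhds (lt_mem_nhds (half_lt_self hk))
  obtain ⟨m, hm1, hm2, hm3⟩ := (hev.and (hev2.and self_mem_nhdsWithin)).exists
  have hm3 : m < x := hm3
  have hne : {t : ℝ | 0 < t ∧
      ((k + 1 : ℕ) : Cardinal) ≤ Module.rank ℝ ↥(⨆ ν ∈ Set.Ici t, eigenspace T ν)}.Nonempty := by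
    by_contra h
    rw [Set.not_nonempty_iff_eq_empty] at h
    rw [hx, eigenvalue, h, Real.sSup_empty] at hk
    exact lt_irrefl _ hk
  obtain ⟨t, ⟨ht0, htr⟩, hmt⟩ := exists_lt_of_lt_csSup hne hm3
  obtain ⟨s, hc, hs⟩ := exists_finset_of_le_rank e hT hl hsum ht0 htr
  refine ⟨s, hc, fun i hi => ?_⟩
  by_contra h
  have h1 := hm1 i (by simpa using (hm2.trans hmt).le.trans (hs i hi)) (not_le.1 h)
  linarith [hs i hi]

/-- Greedy choice: `n + 1` indices carry values at least `eigenvalue T n`, and at most `n` have been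
used, so a fresh one exists. A zero eigenvalue needs no index. -/
lemma exists_finset_sum_eigenvalue_le (hT : (T : H →ₗ[ℝ] H).IsSymmetric) (hl : ∀ i, T (e i) = l i • e i)
    (hsum : Summable l)
    (n : ℕ) :
    ∃ s : Finset ι, s.card ≤ n ∧ ∑ k ∈ Finset.range n, ENNReal.ofReal (eigenvalue T k ^ 2) ≤
      ∑ i ∈ s, ENNReal.ofReal (l i ^ 2) := by
  classical
  induction n with
  | zero => exact ⟨∅, by simp, by simp⟩
  | succ n ih =>
    obtain ⟨s, hc, hs⟩ := ih
    rcases (eigenvalue_nonneg T n).eq_or_lt with h | h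
    · refine ⟨s, by omega, ?_⟩
      rw [Finset.sum_range_succ, ← h]
      simpa using hs
    · obtain ⟨s', hc', hs'⟩ := exists_finset_eigenvalue_le e hT hl hsum h
      obtain ⟨i, hi, his⟩ := Finset.exists_mem_notMem_of_card_lt_card (by omega : s.card < s'.card)
      refine ⟨insert i s, by rw [Finset.card_insert_of_notMem his]; omega, ?_⟩
      rw [Finset.sum_range_succ, Finset.sum_insert his, add_comm]
      gcongr
      exact hs' i hi

lemma tailSq_zero_le (hT : (T : H →ₗ[ℝ] H).IsSymmetric) (hl : ∀ i, T (e i) = l i • e i)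
    (hsum : Summable l) : tailSq T 0 ≤ ∑' i, ENNReal.ofReal (l i ^ 2) := by
  rw [tailSq]
  refine ENNReal.tsum_le_of_sum_range_le fun n => ?_
  obtain ⟨s, -, hs⟩ := exists_finset_sum_eigenvalue_le e hT hl hsum n
  simp only [zero_add]
  exact hs.trans (ENNReal.sum_le_tsum s)

lemma tailSq_zero_eq_add (T : H →L[ℝ] H) :
    tailSq T 0 = ENNReal.ofReal (eigenvalue T 0 ^ 2) + tailSq T 1 := by
  rw [tailSq, tsum_eq_zero_add' ENNReal.summable, tailSq]
  simp [add_comm]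

lemma tailSq_zero_ne_top (hT : (T : H →ₗ[ℝ] H).IsSymmetric) (hl : ∀ i, T (e i) = l i • e i)
    (hl0 : ∀ i, 0 ≤ l i) (hsum : Summable l) : tailSq T 0 ≠ ∞ := by
  refine ne_top_of_le_ne_top ?_ (tailSq_zero_le e hT hl hsum)
  have h2 : Summable fun i => l i ^ 2 := by
    refine Summable.of_nonneg_of_le (fun i => sq_nonneg _) (fun i => ?_)
      (hsum.mul_left (∑' i, l i))
    rw [sq]
    exact mul_le_mul_of_nonneg_right (hsum.le_tsum i fun j _ => hl0 j) (hl0 i)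
  rw [← ENNReal.ofReal_tsum_of_nonneg (fun i => sq_nonneg _) h2]
  exact ENNReal.ofReal_ne_top

lemma le_eigenvalue_zero (hT : (T : H →ₗ[ℝ] H).IsSymmetric) (hl : ∀ i, T (e i) = l i • e i)
    (hl0 : ∀ i, 0 ≤ l i) (hsum : Summable l)
    (i : ι) : l i ≤ eigenvalue T 0 :=
  le_eigenvalue e hT hl hl0 hsum (s := {i}) (by simp) (by simp)

lemma exists_eq_eigenvalue_zero (hT : (T : H →ₗ[ℝ] H).IsSymmetric) (hl : ∀ i, T (e i) = l i • e i)
    (hl0 : ∀ i, 0 ≤ l i) (hsum : Summable l)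
    (h : 0 < eigenvalue T 0) : ∃ i, l i = eigenvalue T 0 := by
  obtain ⟨s, hc, hs⟩ := exists_finset_eigenvalue_le e hT hl hsum h
  obtain ⟨i, hi⟩ := Finset.card_pos.1 (by omega : 0 < s.card)
  exact ⟨i, le_antisymm (le_eigenvalue_zero e hT hl hl0 hsum i) (hs i hi)⟩

lemma le_eigenvalue_one (hT : (T : H →ₗ[ℝ] H).IsSymmetric) (hl : ∀ i, T (e i) = l i • e i)
    (hl0 : ∀ i, 0 ≤ l i) (hsum : Summable l)
    {i j : ι} (hj : l j = eigenvalue T 0) (hij : i ≠ j) :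
    l i ≤ eigenvalue T 1 := by
  classical
  refine le_eigenvalue e hT hl hl0 hsum (s := {i, j}) (Finset.card_pair hij) fun k hk => ?_
  rcases Finset.mem_insert.1 hk with rfl | hk
  · exact le_rfl
  · rw [Finset.mem_singleton.1 hk, hj]
    exact le_eigenvalue_zero e hT hl hl0 hsum i

lemma exists_ne_eigenvalue_le (hT : (T : H →ₗ[ℝ] H).IsSymmetric) (hl : ∀ i, T (e i) = l i • e i)
    (hl0 : ∀ i, 0 ≤ l i) (hsum : Summable l)
    (h : 0 < eigenvalue T 1) :
    ∃ i j, i ≠ j ∧ l i = eigenvalue T 0 ∧ eigenvalue T 1 ≤ l j := by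
  obtain ⟨s, hc, hs⟩ := exists_finset_eigenvalue_le e hT hl hsum h
  obtain ⟨i0, hi0⟩ := Finset.card_pos.1 (by omega : 0 < s.card)
  have h0 : 0 < eigenvalue T 0 :=
    h.trans_le ((hs i0 hi0).trans (le_eigenvalue_zero e hT hl hl0 hsum i0))
  obtain ⟨i, hi⟩ := exists_eq_eigenvalue_zero e hT hl hl0 hsum h0
  obtain ⟨j, hj, hne⟩ := Finset.exists_mem_ne (by omega : 1 < s.card) i
  exact ⟨i, j, hne.symm, hi, hs j hj⟩

end Eigenvalues

/-! ### Nuclear norm and eigenbases -/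

section Nuclear

variable {H : Type*} [NormedAddCommGroup H] [InnerProductSpace ℝ H] {T : H →L[ℝ] H}

lemma card_le_eigenMult {ι : Type*} {e : ι → H} (he : Orthonormal ℝ e) {l : ι → ℝ}
    (hl : ∀ i, T (e i) = l i • e i) {ν : ℝ} {s : Finset ι} (hs : ∀ i ∈ s, l i = ν) :
    (s.card : ℕ∞) ≤ eigenMult T ν := by
  have h := card_le_rank_iSup_eigenspace he hl (A := {ν}) (s := s) (by simpa using hs)
  have h1 : (⨆ μ ∈ ({ν} : Set ℝ), eigenspace T μ) = eigenspace T ν := by simp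
  rw [h1] at h
  have := Cardinal.toENat.monotone' h
  simpa [eigenMult] using this

/-- Indices are grouped by eigenvalue; orthonormality bounds the size of each group by the
multiplicity. -/
lemma tsum_abs_le_nuclearNorm {ι : Type*} {e : ι → H} (he : Orthonormal ℝ e) {l : ι → ℝ}
    (hl : ∀ i, T (e i) = l i • e i) : ∑' i, ENNReal.ofReal |l i| ≤ nuclearNorm T := by
  classical
  rw [ENNReal.tsum_eq_iSup_sum]
  refine iSup_le fun s => ?_
  rw [nuclearNorm]
  refine le_trans ?_ (ENNReal.sum_le_tsum (s.image l))
  rw [← Finset.sum_fiberwise_of_maps_to (s := s) (t := s.image l) (g := l)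
    (fun i hi => Finset.mem_image_of_mem _ hi)]
  refine Finset.sum_le_sum fun ν _ => ?_
  have h1 : ∀ i ∈ s.filter (fun i => l i = ν), ENNReal.ofReal |l i| = ENNReal.ofReal |ν| :=
    fun i hi => by rw [(Finset.mem_filter.1 hi).2]
  rw [Finset.sum_congr rfl h1, Finset.sum_const, nsmul_eq_mul, mul_comm]
  gcongr
  have h2 := card_le_eigenMult he hl (ν := ν) (s := s.filter (fun i => l i = ν))
    (fun i hi => (Finset.mem_filter.1 hi).2)
  have h3 := ENat.toENNReal_mono h2
  simpa using h3

end Nuclear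

/-! ### Integrable majorants for the characteristic function -/

lemma one_add_rpow_le {A M y : ℝ} (hA : 0 ≤ A) (hM : 0 < M) (hy : 0 ≤ y) (hyM : y ≤ M) :
    (1 + A * y) ^ (-(1 / 4) : ℝ) ≤ (1 + A * M) ^ (-(y / (4 * M))) := by
  have h := rpow_one_add_le_one_add_mul_self (s := A * M) (by nlinarith [mul_nonneg hA hM.le])
    (p := y / M) (by positivity) ((div_le_one hM).2 hyM)
  have h1 : 1 + y / M * (A * M) = 1 + A * y := by field_simp
  rw [h1] at h
  have h2 : (0 : ℝ) < 1 + A * M := by positivity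
  calc (1 + A * y) ^ (-(1 / 4) : ℝ) ≤ ((1 + A * M) ^ (y / M)) ^ (-(1 / 4) : ℝ) :=
        Real.rpow_le_rpow_of_nonpos (by positivity) h (by norm_num)
    _ = _ := by
        rw [← Real.rpow_mul h2.le]
        congr 1; field_simp

/-- Bernoulli's inequality replaces every factor by a power of the common base `1 + 4 t² M`, and the
exponents add up. Any total above `2 M` would give integrable decay; `5/2 * M` gives decay
`|t|^(-5/4)` and leaves room for a finite subset of a family with total `3 M`. -/
lemma prod_rpow_le {ι : Type*} {l : ι → ℝ} {M : ℝ} (hM : 0 < M) {s : Finset ι}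
    (h1 : ∀ i ∈ s, l i ^ 2 ≤ M) (h2 : 5 / 2 * M ≤ ∑ i ∈ s, l i ^ 2) (t : ℝ) :
    ∏ i ∈ s, (1 + 4 * t ^ 2 * l i ^ 2) ^ (-(1 / 4) : ℝ) ≤
      (1 + 4 * t ^ 2 * M) ^ (-(5 / 4) / 2 : ℝ) := by
  have hpos : (0 : ℝ) < 1 + 4 * t ^ 2 * M := by positivity
  calc _ ≤ ∏ i ∈ s, (1 + 4 * t ^ 2 * M) ^ (-(l i ^ 2 / (4 * M))) :=
        Finset.prod_le_prod (fun i _ => by positivity) fun i hi =>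
          one_add_rpow_le (by positivity) hM (sq_nonneg _) (h1 i hi)
    _ = (1 + 4 * t ^ 2 * M) ^ (∑ i ∈ s, -(l i ^ 2 / (4 * M))) := by
        rw [Real.rpow_sum_of_pos hpos]
    _ ≤ _ := by
        refine Real.rpow_le_rpow_of_exponent_le
          (by nlinarith [sq_nonneg t, mul_nonneg (sq_nonneg t) hM.le]) ?_
        rw [Finset.sum_neg_distrib, ← Finset.sum_div]
        have : 5 / 8 ≤ (∑ i ∈ s, l i ^ 2) / (4 * M) := by
          rw [le_div_iff₀ (by positivity)]; linarith
        linarith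

/-- The majorant of the characteristic function when no eigenvalue dominates. -/
def decay (u : ℝ) : ℝ := (1 + ‖u‖ ^ 2) ^ (-(5 / 4) / 2 : ℝ)

/-- The majorant of the characteristic function when the largest eigenvalue dominates. -/
def singularDecay (u : ℝ) : ℝ := |u| ^ (-(1 / 2) : ℝ) * decay u

lemma integrable_decay : Integrable decay :=
  integrable_rpow_neg_one_add_norm_sq (by simp; norm_num)

lemma decay_nonneg (u : ℝ) : 0 ≤ decay u := by unfold decay; positivity

lemma decay_le_one (u : ℝ) : decay u ≤ 1 :=
  Real.rpow_le_one_of_one_le_of_nonpos (by nlinarith [sq_nonneg ‖u‖]) (by norm_num)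

lemma decay_neg (u : ℝ) : decay (-u) = decay u := by simp [decay]

lemma singularDecay_nonneg (u : ℝ) : 0 ≤ singularDecay u :=
  mul_nonneg (by positivity) (decay_nonneg u)

lemma measurable_decay : Measurable decay := by unfold decay; fun_prop

/-- Near zero the singularity of order `1/2` is integrable and `decay` is bounded; away from zero
`decay` dominates. -/
lemma integrable_singularDecay : Integrable singularDecay := by
  have hmeas : Measurable singularDecay := by
    have := measurable_decay
    unfold singularDecay; fun_prop
  have h1 : IntegrableOn singularDecay (Set.Ioc 0 1) := by
    have h := (intervalIntegral.intervalIntegrable_rpow' (a := 0) (b := 1)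
      (r := -(1 / 2)) (by norm_num)).1
    refine h.mono' hmeas.aestronglyMeasurable ?_
    filter_upwards [ae_restrict_mem measurableSet_Ioc] with u hu
    rw [Real.norm_of_nonneg (singularDecay_nonneg u), singularDecay, abs_of_pos hu.1]
    exact mul_le_of_le_one_right (Real.rpow_nonneg hu.1.le _) (decay_le_one u)
  have h2 : IntegrableOn singularDecay (Set.Ioi 1) := by
    refine integrable_decay.integrableOn.mono' hmeas.aestronglyMeasurable ?_
    filter_upwards [ae_restrict_mem measurableSet_Ioi] with u hu
    have hu : 1 < u := hu
    rw [Real.norm_of_nonneg (singularDecay_nonneg u), singularDecay, abs_of_pos (by linarith)]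
    exact mul_le_of_le_one_left (decay_nonneg u)
      (Real.rpow_le_one_of_one_le_of_nonpos hu.le (by norm_num))
  have h3 : IntegrableOn singularDecay (Set.Ioi 0) := by
    rw [← Set.Ioc_union_Ioi_eq_Ioi zero_le_one]; exact h1.union h2
  have h4 := (integrable_indicator_iff measurableSet_Ioi).2 h3
  refine (h4.add h4.comp_neg).mono' hmeas.aestronglyMeasurable ?_
  filter_upwards [compl_mem_ae_iff.2 (measure_singleton (0 : ℝ))] with u hu
  have hu : u ≠ 0 := hu
  rw [Real.norm_of_nonneg (singularDecay_nonneg u)]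
  simp only [Pi.add_apply]
  rcases lt_or_gt_of_ne hu with h | h
  · rw [Set.indicator_of_mem (show -u ∈ Set.Ioi 0 by simpa using h),
      Set.indicator_of_notMem (by simpa using h.le)]
    simp [singularDecay, decay_neg]
  · rw [Set.indicator_of_mem (show u ∈ Set.Ioi 0 from h)]
    have : 0 ≤ (Set.Ioi (0 : ℝ)).indicator singularDecay (-u) :=
      Set.indicator_nonneg (fun x _ => singularDecay_nonneg x) _
    linarith

lemma decay_comp_mul {M : ℝ} (hM : 0 < M) (t : ℝ) :
    decay (2 * √M * t) = (1 + 4 * t ^ 2 * M) ^ (-(5 / 4) / 2 : ℝ) := by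
  rw [decay]
  congr 2
  rw [Real.norm_eq_abs, sq_abs, mul_pow, mul_pow, Real.sq_sqrt hM.le]; ring

lemma integral_decay_comp_mul {M : ℝ} (hM : 0 < M) :
    ∫ t, decay (2 * √M * t) = (∫ u, decay u) / (2 * √M) := by
  have hpos : 0 < 2 * √M := by positivity
  rw [Measure.integral_comp_mul_left decay, abs_of_pos (inv_pos.2 hpos), smul_eq_mul, inv_mul_eq_div]

/-- Dropping the summand `1` in the dominant factor makes it homogeneous in `t`, so `L` scales out
separately from `√M`. At `t = 0` the convention for negative powers of zero would make the right
side vanish. -/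
lemma norm_rpow_mul_decay_le {L M : ℝ} (hL : 0 < L) (hM : 0 < M) {t : ℝ} (ht : t ≠ 0) :
    (1 + 4 * t ^ 2 * L ^ 2) ^ (-(1 / 4) : ℝ) * decay (2 * √M * t) ≤
      (L / √M) ^ (-(1 / 2) : ℝ) * singularDecay (2 * √M * t) := by
  have hMs : 0 < √M := by positivity
  have ht' : 0 < |t| := abs_pos.2 ht
  have h1 : (1 + 4 * t ^ 2 * L ^ 2) ^ (-(1 / 4) : ℝ) ≤ (4 * t ^ 2 * L ^ 2) ^ (-(1 / 4) : ℝ) :=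
    Real.rpow_le_rpow_of_nonpos (by positivity) (by linarith) (by norm_num)
  have h2 : (4 * t ^ 2 * L ^ 2) ^ (-(1 / 4) : ℝ) =
      (L / √M) ^ (-(1 / 2) : ℝ) * |2 * √M * t| ^ (-(1 / 2) : ℝ) := by
    rw [← Real.mul_rpow (by positivity) (by positivity), abs_mul, abs_of_pos (by positivity)]
    have e : 4 * t ^ 2 * L ^ 2 = (2 * L * |t|) ^ (2 : ℝ) := by
      rw [Real.rpow_two, mul_pow, mul_pow, sq_abs]; ring
    have e2 : L / √M * (2 * √M * |t|) = 2 * L * |t| := by field_simp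
    rw [e, e2, ← Real.rpow_mul (by positivity)]
    norm_num
  rw [singularDecay, ← mul_assoc, ← h2]
  exact mul_le_mul_of_nonneg_right h1 (decay_nonneg _)

lemma tail_eq_ofReal {H : Type*} [NormedAddCommGroup H] [InnerProductSpace ℝ H] (T : H →L[ℝ] H)
    (k : ℕ) (h : tailSq T k ≠ ∞) :
    tail T k = ENNReal.ofReal √(tailSq T k).toReal := by
  rw [tail, Real.sqrt_eq_rpow, ← ENNReal.ofReal_rpow_of_nonneg ENNReal.toReal_nonneg (by norm_num),
    ENNReal.ofReal_toReal h]

/-! ### Anti-concentration with constant `kappa` -/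

section Kappa

variable {H : Type*} [NormedAddCommGroup H] [InnerProductSpace ℝ H] [CompleteSpace H]
  [SecondCountableTopology H] [MeasurableSpace H] [BorelSpace H] (μ : Measure H) [IsGaussian μ]

lemma antiConc_normSqLaw_of_spread (h0 : ∫ z, z ∂μ = 0) {ι : Type*} {e : ι → H}
    (he : Orthonormal ℝ e) {l : ι → ℝ} (hl : ∀ i, covarianceOperator μ (e i) = l i • e i)
    (hl0 : ∀ i, 0 ≤ l i) {M : ℝ} (hM : 0 < M) {s : Finset ι}
    (h1 : ∀ i ∈ s, l i ^ 2 ≤ M) (h2 : 5 / 2 * M ≤ ∑ i ∈ s, l i ^ 2) (b : H) :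
    AntiConc (normSqLaw μ b) (ENNReal.ofReal ((∫ u, decay u) / (2 * √M))) := by
  rw [← integral_decay_comp_mul hM]
  refine antiConc_of_charFun_le
    (integrable_decay.comp_mul_left' (by positivity)) (Filter.Eventually.of_forall fun t => ?_)
  rw [decay_comp_mul hM]
  exact (norm_charFun_normSqLaw_le he hl0 s t μ h0 (fun i _ => hl i) b).trans
    (prod_rpow_le hM h1 h2 t)

lemma antiConc_normSqLaw_of_dominant (h0 : ∫ z, z ∂μ = 0) {ι : Type*} {e : ι → H}
    (he : Orthonormal ℝ e) {l : ι → ℝ} (hl : ∀ i, covarianceOperator μ (e i) = l i • e i)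
    (hl0 : ∀ i, 0 ≤ l i) {M : ℝ} (hM : 0 < M) {s : Finset ι} {j : ι} (hj : j ∉ s)
    (hlj : 0 < l j) (h1 : ∀ i ∈ s, l i ^ 2 ≤ M) (h2 : 5 / 2 * M ≤ ∑ i ∈ s, l i ^ 2) (b : H) :
    AntiConc (normSqLaw μ b)
      (ENNReal.ofReal ((∫ u, singularDecay u) / 2 * (l j * √M) ^ (-(1 / 2) : ℝ))) := by
  classical
  have hMs : 0 < √M := by positivity
  have hint : ∫ t, (l j / √M) ^ (-(1 / 2) : ℝ) * singularDecay (2 * √M * t) =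
      (∫ u, singularDecay u) / 2 * (l j * √M) ^ (-(1 / 2) : ℝ) := by
    have hpos : 0 < 2 * √M := by positivity
    rw [integral_const_mul, Measure.integral_comp_mul_left singularDecay,
      abs_of_pos (inv_pos.2 hpos), smul_eq_mul]
    have : (l j / √M) ^ (-(1 / 2) : ℝ) = (l j * √M) ^ (-(1 / 2) : ℝ) * √M := by
      rw [show l j / √M = (l j * √M) * (√M ^ (-2 : ℝ)) by
        rw [Real.rpow_neg hMs.le, Real.rpow_two]; field_simp,
        Real.mul_rpow (by positivity) (by positivity), ← Real.rpow_mul hMs.le]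
      norm_num
    rw [this]
    field_simp
  rw [← hint]
  refine antiConc_of_charFun_le
    ((integrable_singularDecay.comp_mul_left' (by positivity)).const_mul _) ?_
  filter_upwards [compl_mem_ae_iff.2 (measure_singleton (0 : ℝ))] with t ht
  refine (norm_charFun_normSqLaw_le he hl0 (insert j s) t μ h0 (fun i _ => hl i) b).trans ?_
  rw [Finset.prod_insert hj]
  refine le_trans ?_ (norm_rpow_mul_decay_le hlj hM ht)
  rw [decay_comp_mul hM]
  exact mul_le_mul_of_nonneg_left (prod_rpow_le hM h1 h2 t) (by positivity)

lemma antiConc_normSqLaw_of_pair (h0 : ∫ z, z ∂μ = 0) {ι : Type*} {e : ι → H}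
    (he : Orthonormal ℝ e) {l : ι → ℝ} (hl : ∀ i, covarianceOperator μ (e i) = l i • e i)
    {i j : ι} (hij : i ≠ j) (hi : 0 < l i) (hj : 0 < l j) (b : H) :
    AntiConc (normSqLaw μ b) (ENNReal.ofReal (√(l i * l j))⁻¹) := by
  have hij' : inner ℝ (e i) (e j) = 0 := he.2 hij
  rw [normSqLaw_eq_conv μ h0 (he.1 i) (hl i), normSqLaw_eq_conv (μ.map (dropDir (e i)))
    (integral_map_dropDir μ h0 _) (he.1 j) (l := l j) ?_, ← Measure.conv_assoc]
  · have := antiConc_sqGaussian_conv (v := (l i).toNNReal) (w := (l j).toNNReal)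
      (by simpa using hi) (by simpa using hj) (inner ℝ (e i) b)
      (inner ℝ (e j) (dropDir (e i) b))
    rw [Real.coe_toNNReal _ hi.le, Real.coe_toNNReal _ hj.le] at this
    exact this.conv
  · rw [covarianceOperator_map_dropDir μ _ _ hij', hl j, map_smul, dropDir_of_inner_eq_zero hij']

/-- The absolute constant in the anti-concentration inequality. -/
def antiConst : ℝ := (∫ u, decay u) + (∫ u, singularDecay u) + 1

lemma antiConst_bounds : 0 ≤ (∫ u, decay u) ∧ 0 ≤ (∫ u, singularDecay u) :=
  ⟨integral_nonneg decay_nonneg, integral_nonneg singularDecay_nonneg⟩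

lemma antiConst_pos : 0 < antiConst := by
  have := antiConst_bounds
  unfold antiConst; linarith

/-- As `5/2 * (Q / 3) < Q`, a finite subset suffices. Discarding zero terms later keeps the dominant
index out of the set. -/
lemma exists_finset_of_le_tsum {ι : Type*} {f : ι → ℝ} (hf : ∀ i, 0 ≤ f i) {Q : ℝ} (hQ : 0 < Q)
    (h : ENNReal.ofReal Q ≤ ∑' i, ENNReal.ofReal (f i)) :
    ∃ s : Finset ι, 5 / 2 * (Q / 3) ≤ ∑ i ∈ s, f i ∧ ∀ i ∈ s, f i ≠ 0 := by
  classical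
  have h1 : ENNReal.ofReal (5 / 2 * (Q / 3)) < ∑' i, ENNReal.ofReal (f i) :=
    lt_of_lt_of_le ((ENNReal.ofReal_lt_ofReal_iff hQ).2 (by linarith)) h
  rw [ENNReal.tsum_eq_iSup_sum, lt_iSup_iff] at h1
  obtain ⟨s, hs⟩ := h1
  rw [← ENNReal.ofReal_sum_of_nonneg fun i _ => hf i] at hs
  refine ⟨s.filter fun i => f i ≠ 0, ?_, fun i hi => (Finset.mem_filter.1 hi).2⟩
  rw [Finset.sum_filter_ne_zero]
  by_contra hlt
  exact absurd hs (not_lt.2 (ENNReal.ofReal_le_ofReal (not_le.1 hlt).le))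

/-- The three branches of `kappa` match the spread, dominant and pair estimates. In the first two,
`M` is a third of the squared tail, which the branch condition makes an upper bound for each squared
eigenvalue used; a vanishing tail makes `kappa` infinite. In the third, the failed conditions force
two positive eigenvalues. -/
lemma antiConc_normSqLaw_kappa (h0 : ∫ z, z ∂μ = 0) {ι : Type*} (e : HilbertBasis ι ℝ H)
    {l : ι → ℝ} (hl : ∀ i, covarianceOperator μ (e i) = l i • e i) (hl0 : ∀ i, 0 ≤ l i)
    (hsum : Summable l) (b : H) :
    AntiConc (normSqLaw μ b) (ENNReal.ofReal antiConst * kappa (covarianceOperator μ)) := by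
  classical
  set T := covarianceOperator μ with hTdef
  have hT : (T : H →ₗ[ℝ] H).IsSymmetric := isPositive_covarianceOperator.1
  have hC := antiConst_bounds
  have htop0 := tailSq_zero_ne_top e hT hl hl0 hsum
  have htop1 : tailSq T 1 ≠ ∞ := ne_top_of_le_ne_top htop0 (by
    rw [tailSq_zero_eq_add T]; exact le_add_self)
  have hle0 := le_eigenvalue_zero e hT hl hl0 hsum
  have htopK : ∀ {x : ℝ≥0∞}, x = ∞ → AntiConc (normSqLaw μ b) (ENNReal.ofReal antiConst * x) := by
    rintro x rfl
    rw [ENNReal.mul_top (by simpa using antiConst_pos)]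
    exact antiConc_top _
  have hspread : ∀ {x : ℝ} {k : ℕ}, tailSq T k ≠ ∞ → 3 * ENNReal.ofReal (x ^ 2) ≤ tailSq T k →
      x ^ 2 ≤ (tailSq T k).toReal / 3 := by
    intro x k hk hx
    rw [← ENNReal.ofReal_toReal hk, show (3 : ℝ≥0∞) = ENNReal.ofReal 3 by simp,
      ← ENNReal.ofReal_mul (by norm_num), ENNReal.ofReal_le_ofReal_iff ENNReal.toReal_nonneg] at hx
    linarith
  have hsq3 : √3 ≤ 2 := by
    rw [Real.sqrt_le_left (by norm_num)]; norm_num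
  rw [kappa]
  split_ifs with hc1 hc2
  · -- no eigenvalue dominates
    rcases eq_or_ne (tailSq T 0) 0 with hz | hz
    · exact htopK (by rw [tail, hz]; simp)
    have hQ : 0 < (tailSq T 0).toReal := ENNReal.toReal_pos hz htop0
    rw [tail_eq_ofReal T 0 htop0]
    have hM := hspread htop0 hc1
    set Q := (tailSq T 0).toReal with hQdef
    obtain ⟨s, hs, -⟩ := exists_finset_of_le_tsum (f := fun i => l i ^ 2) (fun i => sq_nonneg _) hQ
      (by rw [hQdef, ENNReal.ofReal_toReal htop0]; exact tailSq_zero_le e hT hl hsum)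
    have hM0 : 0 < Q / 3 := by positivity
    refine (antiConc_normSqLaw_of_spread μ h0 e.orthonormal hl hl0 hM0 (s := s) (fun i _ => ?_)
      hs b).mono ?_
    · exact (pow_le_pow_left₀ (hl0 i) (hle0 i) 2).trans hM
    · rw [← ENNReal.ofReal_inv_of_pos (by positivity), ← ENNReal.ofReal_mul antiConst_pos.le]
      refine ENNReal.ofReal_le_ofReal ?_
      rw [Real.sqrt_div hQ.le, ← div_eq_mul_inv,
        show (∫ u, decay u) / (2 * (√Q / √3)) = ((∫ u, decay u) * (√3 / 2)) / √Q by
          field_simp]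
      refine div_le_div_of_nonneg_right ?_ (by positivity)
      unfold antiConst
      nlinarith [hC.1, hC.2]
  · -- exactly one eigenvalue dominates
    have hev0 : 0 < eigenvalue T 0 := by
      refine (eigenvalue_nonneg T 0).lt_of_ne fun h => hc1 ?_
      rw [← h]; simp
    rcases eq_or_ne (tailSq T 1) 0 with hz | hz
    · refine htopK ?_
      rw [tail, hz]
      simp
    have hQ : 0 < (tailSq T 1).toReal := ENNReal.toReal_pos hz htop1
    rw [tail_eq_ofReal T 1 htop1]
    have hM := hspread htop1 hc2
    set Q := (tailSq T 1).toReal with hQdef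
    obtain ⟨j, hj⟩ := exists_eq_eigenvalue_zero e hT hl hl0 hsum hev0
    -- The basis vector `j` realises the largest eigenvalue, so its finite square cancels from both
    -- sides of `tailSq_zero_le`.
    have htail : ENNReal.ofReal Q ≤
        ∑' i, ENNReal.ofReal (if i = j then 0 else l i ^ 2) := by
      rw [hQdef, ENNReal.ofReal_toReal htop1]
      have h1 := tailSq_zero_le e hT hl hsum
      rw [tailSq_zero_eq_add T, ENNReal.tsum_eq_add_tsum_ite j, hj,
        ENNReal.add_le_add_iff_left ENNReal.ofReal_ne_top] at h1
      refine h1.trans (le_of_eq (tsum_congr fun i => ?_))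
      split_ifs <;> simp
    obtain ⟨s, hs, hs0⟩ := exists_finset_of_le_tsum
      (f := fun i => if i = j then 0 else l i ^ 2) (fun i => by positivity) hQ htail
    have hne : ∀ i ∈ s, i ≠ j := fun i hi h => hs0 i hi (by simp [h])
    have hs' : 5 / 2 * (Q / 3) ≤ ∑ i ∈ s, l i ^ 2 := by
      refine hs.trans (le_of_eq (Finset.sum_congr rfl fun i hi => ?_))
      rw [if_neg (hne i hi)]
    have hM0 : 0 < Q / 3 := by positivity
    refine (antiConc_normSqLaw_of_dominant μ h0 e.orthonormal hl hl0 hM0 (s := s) (j := j)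
      (fun h => hne j h rfl) (hj ▸ hev0) (fun i hi => ?_) hs' b).mono ?_
    · exact (pow_le_pow_left₀ (hl0 i)
        (le_eigenvalue_one e hT hl hl0 hsum hj (hne i hi)) 2).trans hM
    · rw [← ENNReal.ofReal_mul hev0.le, ENNReal.ofReal_rpow_of_pos (by positivity),
        ← ENNReal.ofReal_mul antiConst_pos.le]
      refine ENNReal.ofReal_le_ofReal ?_
      -- Passing from `Q / 3` to `Q` costs `3^(1/4)`; the bound `2` cancels the `1/2` in front of
      -- the integral.
      have h1 : (l j * √(Q / 3)) ^ (-(1 / 2) : ℝ) ≤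
          2 * (eigenvalue T 0 * √Q) ^ (-(1 / 2) : ℝ) := by
        have e1 : l j * √(Q / 3) = (eigenvalue T 0 * √Q) * (√3)⁻¹ := by
          rw [hj, Real.sqrt_div hQ.le]; field_simp
        rw [e1, Real.mul_rpow (by positivity) (by positivity), mul_comm]
        refine mul_le_mul_of_nonneg_right ?_ (by positivity)
        rw [Real.rpow_neg (by positivity), Real.inv_rpow (by positivity), inv_inv,
          ← Real.sqrt_eq_rpow]
        rw [Real.sqrt_le_left (by norm_num)]
        linarith
      have h2 : 0 ≤ (eigenvalue T 0 * √Q) ^ (-(1 / 2) : ℝ) := by positivity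
      calc _ ≤ (∫ u, singularDecay u) / 2 * (2 * (eigenvalue T 0 * √Q) ^ (-(1 / 2) : ℝ)) :=
            mul_le_mul_of_nonneg_left h1 (by linarith [hC.2])
        _ = (∫ u, singularDecay u) * (eigenvalue T 0 * √Q) ^ (-(1 / 2) : ℝ) := by ring
        _ ≤ _ := by
            refine mul_le_mul_of_nonneg_right ?_ h2
            unfold antiConst; linarith [hC.1]
  · -- two eigenvalues dominate
    have hev1 : 0 < eigenvalue T 1 := by
      refine (eigenvalue_nonneg T 1).lt_of_ne fun h => hc2 ?_
      rw [← h]; simp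
    obtain ⟨i, j, hij, hi, hj⟩ := exists_ne_eigenvalue_le e hT hl hl0 hsum hev1
    have hlj : 0 < l j := hev1.trans_le hj
    have hev0 : 0 < eigenvalue T 0 := hlj.trans_le (hle0 j)
    refine (antiConc_normSqLaw_of_pair μ h0 e.orthonormal hl hij (hi ▸ hev0) hlj b).mono ?_
    rw [← ENNReal.ofReal_mul hev0.le, ENNReal.ofReal_rpow_of_pos (by positivity),
      ← ENNReal.ofReal_mul antiConst_pos.le]
    refine ENNReal.ofReal_le_ofReal ?_
    rw [hi, Real.rpow_neg (by positivity), ← Real.sqrt_eq_rpow]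
    have h1 : (√(eigenvalue T 0 * l j))⁻¹ ≤ (√(eigenvalue T 0 * eigenvalue T 1))⁻¹ := by
      gcongr
    refine h1.trans (le_mul_of_one_le_left (by positivity) ?_)
    unfold antiConst; linarith [hC.1, hC.2]

end Kappa

/-! ### Coupling the two covariances and comparing balls -/

lemma inner_apply_self_of_eigenvector {H : Type*} [NormedAddCommGroup H]
    [InnerProductSpace ℝ H] {T : H →L[ℝ] H} {e : H} (he : ‖e‖ = 1) {l : ℝ} (h : T e = l • e) : inner ℝ (T e) e = l := by
  rw [h, real_inner_smul_left, real_inner_self_eq_norm_sq, he]; simp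

lemma measureReal_norm_sub_le {H : Type*} [NormedAddCommGroup H] [MeasurableSpace H]
    [BorelSpace H] {Ω : Type*} [MeasurableSpace Ω] {P : Measure Ω} {ξ : Ω → H}
    (hξ : AEMeasurable ξ P) (a : H) {x : ℝ} (hx : 0 ≤ x) :
    P.real {ω | ‖ξ ω - a‖ ≤ x} = (normSqLaw (P.map ξ) a).real (Set.Iic (x ^ 2)) := by
  have hm : MeasurableSet ((fun z : H => ‖z - a‖ ^ 2) ⁻¹' Set.Iic (x ^ 2)) :=
    measurableSet_Iic.preimage (by fun_prop)
  rw [measureReal_def, measureReal_def, normSqLaw,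
    Measure.map_apply (by fun_prop) measurableSet_Iic, Measure.map_apply_of_aemeasurable hξ hm]
  congr 2
  ext ω
  simp [pow_le_pow_iff_left₀ (norm_nonneg _) hx]

section Comparison

variable {H : Type u} [NormedAddCommGroup H] [InnerProductSpace ℝ H] [CompleteSpace H]
  [SecondCountableTopology H] [MeasurableSpace H] [BorelSpace H]

lemma exists_covariance_basis (μ : Measure H) [IsGaussian μ] :
    ∃ (ι : Type u) (e : HilbertBasis ι ℝ H) (l : ι → ℝ),
      (∀ i, covarianceOperator μ (e i) = l i • e i) ∧ (∀ i, 0 ≤ l i) ∧ Summable l := by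
  obtain ⟨ι, e, l, hl⟩ := exists_hilbertBasis_eigenvectors
    (isCompactOperator_covarianceOperator μ) isPositive_covarianceOperator.1
  have h : ∀ i, inner ℝ (covarianceOperator μ (e i)) (e i) = l i := fun i =>
    inner_apply_self_of_eigenvector (e.orthonormal.1 i) (hl i)
  refine ⟨ι, e, l, hl, fun i => ?_, ?_⟩
  · rw [← h i]; exact isPositive_covarianceOperator.2 (e i)
  · exact (summable_inner_covarianceOperator μ e.orthonormal).congr h

/-- Two centred Gaussian measures become equal after adding independent noises whose total second
moment is at most the nuclear norm of the difference of the covariance operators. -/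
lemma exists_conv_eq_conv (μ ν : Measure H) [IsGaussian μ] [IsGaussian ν] (hμ : ∫ z, z ∂μ = 0)
    (hν : ∫ z, z ∂ν = 0) :
    ∃ γ δ : Measure H, IsProbabilityMeasure γ ∧ IsProbabilityMeasure δ ∧
      μ ∗ γ = ν ∗ δ ∧
      (∫⁻ g, ENNReal.ofReal (‖g‖ ^ 2) ∂γ) + (∫⁻ g, ENNReal.ofReal (‖g‖ ^ 2) ∂δ) ≤
        nuclearNorm (covarianceOperator μ - covarianceOperator ν) := by
  set D := covarianceOperator μ - covarianceOperator ν with hD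
  have hsym : (D : H →ₗ[ℝ] H).IsSymmetric :=
    LinearMap.IsSymmetric.sub (isPositive_covarianceOperator (μ := μ)).1
      (isPositive_covarianceOperator (μ := ν)).1
  have hcomp : IsCompactOperator D :=
    (isCompactOperator_covarianceOperator μ).sub (isCompactOperator_covarianceOperator ν)
  obtain ⟨ι, e, d, hd⟩ := exists_hilbertBasis_eigenvectors hcomp hsym
  -- The diagonal of `D` is a difference of two summable diagonals, and real summability is
  -- absolute.
  have hsum : Summable d := by
    refine ((summable_inner_covarianceOperator μ e.orthonormal).sub
      (summable_inner_covarianceOperator ν e.orthonormal)).congr fun i => ?_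
    rw [← inner_sub_left, ← sub_apply]
    exact inner_apply_self_of_eigenvector (e.orthonormal.1 i) (hd i)
  have hsabs : Summable fun i => |d i| := hsum.abs
  have hsp : Summable fun i => max (d i) 0 :=
    Summable.of_nonneg_of_le (fun i => le_max_right _ _)
      (fun i => max_le (le_abs_self _) (abs_nonneg _)) hsabs
  have hsm : Summable fun i => max (-d i) 0 :=
    Summable.of_nonneg_of_le (fun i => le_max_right _ _)
      (fun i => max_le (neg_le_abs _) (abs_nonneg _)) hsabs
  -- The noise `γ` for `μ` takes the negative part of `D` and the noise `δ` for `ν` the positive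
  -- part, so both sums have the same covariance.
  obtain ⟨γ, hγ1, hγ2, hγ3⟩ := exists_diagonal_measure e (fun i => le_max_right (-d i) 0) hsm
  obtain ⟨δ, hδ1, hδ2, hδ3⟩ := exists_diagonal_measure e (fun i => le_max_right (d i) 0) hsp
  refine ⟨γ, δ, hγ1, hδ1, ?_, ?_⟩
  · refine Measure.ext_of_charFun ?_
    ext x
    rw [charFun_conv, charFun_conv, hγ3, hδ3, charFun_of_centered μ hμ, charFun_of_centered ν hν,
      ← Complex.exp_add, ← Complex.exp_add]
    have hbd : ∀ {c : ι → ℝ}, (∀ i, 0 ≤ c i) → Summable c →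
        Summable fun i => c i * inner ℝ (e i) x ^ 2 := by
      intro c hc hs
      refine Summable.of_nonneg_of_le (fun i => mul_nonneg (hc i) (sq_nonneg _)) (fun i => ?_)
        (hs.mul_right (‖x‖ ^ 2))
      have h1 := abs_real_inner_le_norm (e i) x
      rw [e.orthonormal.1 i, one_mul] at h1
      have h2 : inner ℝ (e i) x ^ 2 ≤ ‖x‖ ^ 2 := by
        rw [← sq_abs]; gcongr
      exact mul_le_mul_of_nonneg_left h2 (hc i)
    have hDx : HasSum (fun i => d i * inner ℝ (e i) x ^ 2) (inner ℝ (D x) x) := by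
      have h := e.hasSum_inner_mul_inner (D x) x
      refine h.congr_fun fun i => ?_
      have h1 : inner ℝ (D x) (e i) = d i * inner ℝ (e i) x := by
        have h2 : inner ℝ (D x) (e i) = inner ℝ x (D (e i)) := hsym x (e i)
        rw [h2, hd, real_inner_smul_right, real_inner_comm]
      rw [h1]; ring
    have hsplit : inner ℝ (D x) x =
        (∑' i, max (d i) 0 * inner ℝ (e i) x ^ 2) - ∑' i, max (-d i) 0 * inner ℝ (e i) x ^ 2 := by
      rw [← hDx.tsum_eq, ← (hbd (fun i => le_max_right _ _) hsp).tsum_sub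
        (hbd (fun i => le_max_right _ _) hsm)]
      refine tsum_congr fun i => ?_
      rw [← sub_mul]
      congr 1
      rcases le_total (d i) 0 with h | h <;> simp [h]
    have hDsub : inner ℝ (D x) x =
        inner ℝ (covarianceOperator μ x) x - inner ℝ (covarianceOperator ν x) x := by
      rw [hD, sub_apply, inner_sub_left]
    have hfin : inner ℝ (covarianceOperator μ x) x + ∑' i, max (-d i) 0 * inner ℝ (e i) x ^ 2 =
        inner ℝ (covarianceOperator ν x) x + ∑' i, max (d i) 0 * inner ℝ (e i) x ^ 2 := by
      linarith
    congr 1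
    rw [← add_div, ← add_div, ← neg_add, ← neg_add]
    norm_cast
    rw [hfin]
  · refine (add_le_add hγ2 hδ2).trans ?_
    refine le_trans (le_of_eq ?_) (tsum_abs_le_nuclearNorm e.orthonormal hd)
    rw [← ENNReal.tsum_add]
    refine tsum_congr fun i => ?_
    rw [← ENNReal.ofReal_add (le_max_right _ _) (le_max_right _ _)]
    congr 1
    rcases le_total (d i) 0 with h | h
    · simp [h, abs_of_nonpos h]
    · simp [h, abs_of_nonneg h]

lemma ofReal_abs_measureReal_sub_le {α β : Type*} [MeasurableSpace α] [MeasurableSpace β]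
    {μ : Measure α} {ν : Measure β} [IsFiniteMeasure μ] [IsFiniteMeasure ν] {A : Set α} {B : Set β}
    {R : ℝ≥0∞} (h1 : μ A ≤ ν B + R) (h2 : ν B ≤ μ A + R) :
    ENNReal.ofReal |μ.real A - ν.real B| ≤ R := by
  rcases le_total (μ.real A) (ν.real B) with h | h
  · rw [abs_sub_comm, abs_of_nonneg (sub_nonneg.2 h), ENNReal.ofReal_sub _ measureReal_nonneg,
      ofReal_measureReal, ofReal_measureReal, tsub_le_iff_left]
    exact h2
  · rw [abs_of_nonneg (sub_nonneg.2 h), ENNReal.ofReal_sub _ measureReal_nonneg,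
      ofReal_measureReal, ofReal_measureReal, tsub_le_iff_left]
    exact h1

/-- Comparison of the probabilities of balls under two centred Gaussian measures. -/
lemma ball_comparison (μ ν : Measure H) [IsGaussian μ] [IsGaussian ν] (hμ : ∫ z, z ∂μ = 0)
    (hν : ∫ z, z ∂ν = 0) (a : H) {y : ℝ} (hy : 0 ≤ y) :
    ENNReal.ofReal |(normSqLaw μ a).real (Set.Iic y) - (normSqLaw ν 0).real (Set.Iic y)| ≤
      ENNReal.ofReal antiConst *
        (kappa (covarianceOperator μ) + kappa (covarianceOperator ν)) *
        (nuclearNorm (covarianceOperator μ - covarianceOperator ν) +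
          ENNReal.ofReal (‖a‖ ^ 2)) := by
  obtain ⟨ι, e, l, hl, hl0, hls⟩ := exists_covariance_basis μ
  obtain ⟨κ, f, m, hm, hm0, hms⟩ := exists_covariance_basis ν
  obtain ⟨γ, δ, hγ, hδ, hconv, hN⟩ := exists_conv_eq_conv μ ν hμ hν
  have hK1 := antiConc_normSqLaw_kappa μ hμ e hl hl0 hls 0
  have hK2 := antiConc_normSqLaw_kappa ν hν f hm hm0 hms 0
  set K1 := ENNReal.ofReal antiConst * kappa (covarianceOperator μ)
  set K2 := ENNReal.ofReal antiConst * kappa (covarianceOperator ν)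
  obtain ⟨h1, h2⟩ := normSqLaw_Iic_shift μ hμ e hl hK1 a hy
  obtain ⟨h3, h4⟩ := normSqLaw_conv_Iic μ hμ e hl hK1 γ hy
  obtain ⟨h5, h6⟩ := normSqLaw_conv_Iic ν hν f hm hK2 δ hy
  rw [hconv] at h3 h4
  rw [mul_add (ENNReal.ofReal antiConst)]
  set N := nuclearNorm (covarianceOperator μ - covarianceOperator ν)
  have hγN : ∫⁻ g, ENNReal.ofReal (‖g‖ ^ 2) ∂γ ≤ N := le_self_add.trans hN
  have hδN : ∫⁻ g, ENNReal.ofReal (‖g‖ ^ 2) ∂δ ≤ N := le_add_self.trans hN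
  refine ofReal_abs_measureReal_sub_le ?_ ?_
  -- In this direction, removing the shift and the noise `δ` only increases the probability; only
  -- removing `γ` from `μ ∗ γ = ν ∗ δ` costs something.
  · calc _ ≤ normSqLaw (ν ∗ δ) 0 (Set.Iic y) + K1 * ∫⁻ g, ENNReal.ofReal (‖g‖ ^ 2) ∂γ :=
          h1.trans h4
      _ ≤ normSqLaw ν 0 (Set.Iic y) + (K1 + K2) * (N + ENNReal.ofReal (‖a‖ ^ 2)) := by
          gcongr
          · exact le_self_add
          · exact hγN.trans le_self_add
  -- In the reverse direction the costs come from adding `δ` to `ν` and from shifting the centre by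
  -- `a`.
  · calc _ ≤ normSqLaw (ν ∗ δ) 0 (Set.Iic y) + K2 * ∫⁻ g, ENNReal.ofReal (‖g‖ ^ 2) ∂δ := h6
      _ ≤ normSqLaw μ a (Set.Iic y) + K1 * ENNReal.ofReal (‖a‖ ^ 2) +
          K2 * ∫⁻ g, ENNReal.ofReal (‖g‖ ^ 2) ∂δ := by
          gcongr
          exact h3.trans h2
      _ ≤ normSqLaw μ a (Set.Iic y) + (K1 + K2) * (N + ENNReal.ofReal (‖a‖ ^ 2)) := by
          rw [add_assoc, add_mul K1]
          gcongr
          · exact le_add_self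
          · exact hδN.trans le_self_add

end Comparison

end GaussianComparison

end

theorem mainTheorem5 :
    ∃ C : ℝ, 0 < C ∧
      ∀ (H : Type*) [NormedAddCommGroup H] [InnerProductSpace ℝ H] [CompleteSpace H]
        [TopologicalSpace.SeparableSpace H] [MeasurableSpace H] [BorelSpace H]
        (Ω : Type*) [MeasurableSpace Ω] (P : Measure Ω) [IsProbabilityMeasure P]
        (ξ η : Ω → H),
        HasGaussianLaw ξ P → HasGaussianLaw η P →
        ∫ ω, ξ ω ∂P = 0 → ∫ ω, η ω ∂P = 0 →
        ∀ a : H,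
          ⨆ (x : ℝ) (_ : 0 < x),
              ENNReal.ofReal |P.real {ω | ‖ξ ω - a‖ ≤ x} - P.real {ω | ‖η ω‖ ≤ x}| ≤
            ENNReal.ofReal C *
              (GaussianComparison.kappa (covarianceOperator (P.map ξ)) +
                GaussianComparison.kappa (covarianceOperator (P.map η))) *
              (GaussianComparison.nuclearNorm
                  (covarianceOperator (P.map ξ) - covarianceOperator (P.map η)) +
                ENNReal.ofReal (‖a‖ ^ 2)) := by
  refine ⟨GaussianComparison.antiConst, GaussianComparison.antiConst_pos, ?_⟩
  intro H _ _ _ _ _ _ Ω _ P _ ξ η hξ hη hξ0 hη0 a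
  have := UniformSpace.secondCountable_of_separable H
  have := hξ.isGaussian_map
  have := hη.isGaussian_map
  have hμ : ∫ z, z ∂(P.map ξ) = 0 := by
    rw [integral_map hξ.aemeasurable (by fun_prop), hξ0]
  have hν : ∫ z, z ∂(P.map η) = 0 := by
    rw [integral_map hη.aemeasurable (by fun_prop), hη0]
  refine iSup₂_le fun x hx => ?_
  have h := GaussianComparison.ball_comparison (P.map ξ) (P.map η) hμ hν a (sq_nonneg x)
  rw [← GaussianComparison.measureReal_norm_sub_le hξ.aemeasurable a hx.le,
    ← GaussianComparison.measureReal_norm_sub_le hη.aemeasurable 0 hx.le] at h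
  simpa only [sub_zero] using h
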